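/- Let $n\ge 2$ and let $\eta=\omega^1\otimes\omega^2+\omega^2\otimes\omega^1+\sum_{i=3}^n\omega^i\otimes\omega^i$ be the Minkowski inner product on $\mathbb{R}^n$, where $\{\omega^i\}$ is dual to the standard basis $\{k,l,m_1,\dots,m_{n-2}\}$. Let $\{k\}^\perp$ be the $\eta$-orthogonal complement of $k$. Let $GN\subset GL(n,\mathbb{R})$ be the group of invertible linear maps $f$ such that $f(k)\in\mathbb{R}k$, $\eta(f(w),f(w'))=\eta(w,w')$ for all $w,w'\in\{k\}^\perp$, and $\eta(f(k),f(z))=\eta(k,z)$ for all $z\in\mathbb{R}^n$. Let $Sim(n-2)=\{f\in O(1,n-1): f(k)\in\mathbb{R}k\}\subset GN$, where $O(1,n-1)$ is the group of linear maps preserving $\eta$. Let $M$ be a smooth $n$-dimensional manifold. For a Lie group $G\subset GL(n,\mathbb{R})$, a $G$-structure on $M$ is a smooth sub-principal bundle $P\to M$ with structure group $G$ of the frame bundle of $M$; its fibre $P_x$ over $x$ consists of linear isomorphisms $u:\mathbb{R}^n\to T_xM$. A $GN$-structure $P$ determines distributions $\lambda_x=u(\mathbb{R}k)$ and $\Lambda_x=u(\{k\}^\perp)$,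 $u\in P_x$, of dimension one and codimension one (they do not depend on $u$); $\lambda$ is called its null distribution. A local vector field $X$ on $M$ is an infinitesimal automorphism of $P$ if the derivatives of its local flow map frames in $P$ to frames in $P$. The $GN$-structure $P$ is a Kundt structure if $\Lambda$ is integrable and about each point of $M$ there is a nowhere vanishing local smooth vector field belonging to $\lambda$ which is an infinitesimal automorphism of $P$. A Lorentzian metric $g$ on $M$ belongs to $P$ if there is a $Sim(n-2)$-structure $Q\subset P$ such that $g(u(v),u(w))=\eta(v,w)$ for all $u\in Q$ and $v,w\in\mathbb{R}^n$. Let $g$ be a smooth Lorentzian metric on $M$ with Levi-Civita connection $\nabla$, and let $\lambda$ be a smooth one-dimensional distribution on $M$. The triple $(M,g,\lambda)$ is a Kundt spacetime if $\lambda$ is null with respect to $g$, $\lambda^\perp$ is integrable, and about each point of $M$ there is a nowhere vanishing local smooth vector field $X$ belonging to $\lambda$ which is affinely geodesic, shear-free and divergence-free, i.e. $$\nabla_XX=0,\qquad \nabla_{(a}X_{b)}\nabla^aX^b=0,\qquad \nabla_aX^a=0 .$$ **Corollary.** If $P\to M$ is a Kundt structure with null distribution $\lambda$, then for each Lorentzian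 metric $g$ belonging to $P$, the triple $(M,g,\lambda)$ is a Kundt spacetime. -/

import Mathlib

open scoped Manifold ContDiff

noncomputable section

namespace Kundt

/-! ### Minkowski space and the structure groups -/

/-- The model space `ℝⁿ`, where `n = m + 2 ≥ 2`. -/
abbrev Model (m : ℕ) : Type := EuclideanSpace ℝ (Fin (m + 2))

/-- The first vector of the standard basis `{k, l, m₁, …, mₘ}` of `ℝⁿ`. -/
def vecK (m : ℕ) : Model m := EuclideanSpace.single 0 1

/-- The Minkowski inner product
`η = ω¹ ⊗ ω² + ω² ⊗ ω¹ + ω³ ⊗ ω³ + ⋯ + ωⁿ ⊗ ωⁿ` on `ℝⁿ`, where `n = m + 2`. -/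
def eta {m : ℕ} (v w : Model m) : ℝ :=
  v 0 * w 1 + v 1 * w 0 + ∑ i : Fin m, v i.succ.succ * w i.succ.succ

theorem eta_smul_left {m : ℕ} (c : ℝ) (v w : Model m) : eta (c • v) w = c * eta v w := by
  simp only [eta, PiLp.smul_apply, smul_eq_mul, mul_add, Finset.mul_sum, mul_assoc]

theorem vecK_ne_zero (m : ℕ) : vecK m ≠ 0 := by
  simp [vecK]

theorem scalar_ne_zero {m : ℕ} {f : Model m ≃L[ℝ] Model m} {c : ℝ}
    (h : f (vecK m) = c • vecK m) : c ≠ 0 := by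
  rintro rfl
  rw [zero_smul] at h
  exact vecK_ne_zero m (f.map_eq_zero_iff.1 h)

theorem symm_vecK {m : ℕ} {f : Model m ≃L[ℝ] Model m} {c : ℝ}
    (h : f (vecK m) = c • vecK m) : f.symm (vecK m) = c⁻¹ • vecK m := by
  rw [ContinuousLinearEquiv.symm_apply_eq, map_smul, h, smul_smul,
    inv_mul_cancel₀ (scalar_ne_zero h), one_smul]

theorem GN_perp {m : ℕ} {f : Model m ≃L[ℝ] Model m}
    (h1 : ∃ c : ℝ, f (vecK m) = c • vecK m)
    (h3 : ∀ z, eta (f (vecK m)) (f z) = eta (vecK m) z) (w : Model m) :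
    eta (vecK m) (f w) = 0 ↔ eta (vecK m) w = 0 := by
  obtain ⟨c, hc⟩ := h1
  rw [← h3 w, hc, eta_smul_left, mul_eq_zero, or_iff_right (scalar_ne_zero hc)]

/-- The group `GN ⊂ GL(n, ℝ)`. -/
def GN (m : ℕ) : Subgroup (Model m ≃L[ℝ] Model m) where
  carrier := {f | (∃ c : ℝ, f (vecK m) = c • vecK m) ∧
    (∀ w w' : Model m, eta (vecK m) w = 0 → eta (vecK m) w' = 0 →
      eta (f w) (f w') = eta w w') ∧
    ∀ z : Model m, eta (f (vecK m)) (f z) = eta (vecK m) z}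
  one_mem' := ⟨⟨1, (one_smul ℝ (vecK m)).symm⟩, fun _ _ _ _ => rfl, fun _ => rfl⟩
  mul_mem' := by
    rintro f g ⟨⟨c, hc⟩, hf2, hf3⟩ ⟨⟨d, hd⟩, hg2, hg3⟩
    refine ⟨⟨d * c, ?_⟩, ?_, ?_⟩
    · change f (g (vecK m)) = _
      rw [hd, map_smul, hc, smul_smul]
    · intro w w' hw hw'
      change eta (f (g w)) (f (g w')) = _
      rw [hf2 _ _ ((GN_perp ⟨d, hd⟩ hg3 w).2 hw) ((GN_perp ⟨d, hd⟩ hg3 w').2 hw'), hg2 _ _ hw hw']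
    · intro z
      change eta (f (g (vecK m))) (f (g z)) = _
      rw [← hg3 z, hd, map_smul, eta_smul_left, hf3, eta_smul_left]
  inv_mem' := by
    rintro f ⟨⟨c, hc⟩, hf2, hf3⟩
    have hp : ∀ w, eta (vecK m) w = 0 → eta (vecK m) (f.symm w) = 0 := fun w hw => by
      rw [← GN_perp ⟨c, hc⟩ hf3, f.apply_symm_apply]
      exact hw
    refine ⟨⟨c⁻¹, symm_vecK hc⟩, ?_, ?_⟩
    · intro w w' hw hw'
      change eta (f.symm w) (f.symm w') = _
      rw [← hf2 _ _ (hp w hw) (hp w' hw'), f.apply_symm_apply, f.apply_symm_apply]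
    · intro z
      change eta (f.symm (vecK m)) (f.symm z) = _
      rw [symm_vecK hc, eta_smul_left, ← hf3, f.apply_symm_apply, hc, eta_smul_left, ← mul_assoc,
        inv_mul_cancel₀ (scalar_ne_zero hc), one_mul]

/-- The group `Sim(n - 2) = {f ∈ O(1, n - 1) : f(k) ∈ ℝk}`. -/
def Sim (m : ℕ) : Subgroup (Model m ≃L[ℝ] Model m) where
  carrier := {f | (∀ v w : Model m, eta (f v) (f w) = eta v w) ∧
    ∃ c : ℝ, f (vecK m) = c • vecK m}
  one_mem' := ⟨fun _ _ => rfl, ⟨1, (one_smul ℝ (vecK m)).symm⟩⟩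
  mul_mem' := by
    rintro f g ⟨hf, ⟨c, hc⟩⟩ ⟨hg, ⟨d, hd⟩⟩
    refine ⟨fun v w => ?_, ⟨d * c, ?_⟩⟩
    · change eta (f (g v)) (f (g w)) = _
      rw [hf, hg]
    · change f (g (vecK m)) = _
      rw [hd, map_smul, hc, smul_smul]
  inv_mem' := by
    rintro f ⟨hf, ⟨c, hc⟩⟩
    refine ⟨fun v w => ?_, ⟨c⁻¹, symm_vecK hc⟩⟩
    change eta (f.symm v) (f.symm w) = _
    rw [← hf, f.apply_symm_apply, f.apply_symm_apply]

/-! ### Vector fields and distributions -/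

/-- `X` is a smooth vector field on `U` (its values outside `U` are irrelevant). -/
def SmoothVectorFieldOn {m : ℕ} {M : Type*} [TopologicalSpace M] [ChartedSpace (Model m) M]
    [IsManifold (𝓡 (m + 2)) ∞ M]
    (X : (x : M) → TangentSpace (𝓡 (m + 2)) x) (U : Set M) : Prop :=
  ContMDiffOn (𝓡 (m + 2)) (𝓡 (m + 2)).tangent ∞
    (fun x => (⟨x, X x⟩ : TangentBundle (𝓡 (m + 2)) M)) U

/-- A field of tangent subspaces is integrable if it is involutive: the bracket of any two local
smooth vector fields belonging to it belongs to it. -/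
def IsIntegrable {m : ℕ} {M : Type*} [TopologicalSpace M] [ChartedSpace (Model m) M]
    [IsManifold (𝓡 (m + 2)) ∞ M]
    (D : (x : M) → Submodule ℝ (TangentSpace (𝓡 (m + 2)) x)) : Prop :=
  ∀ (U : Set M) (V W : (x : M) → TangentSpace (𝓡 (m + 2)) x), IsOpen U →
    SmoothVectorFieldOn V U → SmoothVectorFieldOn W U →
    (∀ x ∈ U, V x ∈ D x) → (∀ x ∈ U, W x ∈ D x) →
    ∀ x ∈ U, VectorField.mlieBracket (𝓡 (m + 2)) V W x ∈ D x

/-! ### `G`-structures -/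

/-- A `G`-structure on `M`: a smooth sub-principal bundle with structure group `G` of the frame
bundle. The fibre over `x` is a `G`-orbit in `GL(ℝⁿ, T_x M)`, and smoothness of the
subbundle is expressed by the existence of smooth local sections. -/
structure GStructure {m : ℕ} (G : Subgroup (Model m ≃L[ℝ] Model m))
    (M : Type*) [TopologicalSpace M] [ChartedSpace (Model m) M]
    [IsManifold (𝓡 (m + 2)) ∞ M] where
  /-- the fibres -/
  fibre : (x : M) → Set (Model m ≃L[ℝ] TangentSpace (𝓡 (m + 2)) x)
  /-- `G` acts on the fibres from the right -/
  act_mem : ∀ (x : M), ∀ u ∈ fibre x, ∀ a ∈ G, a.trans u ∈ fibre x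
  /-- the action on a fibre is transitive -/
  transitive : ∀ (x : M), ∀ u ∈ fibre x, ∀ u' ∈ fibre x, ∃ a ∈ G, u' = a.trans u
  /-- there are smooth sections around every point -/
  exists_section : ∀ p : M, ∃ U : Set M, IsOpen U ∧ p ∈ U ∧
    ∃ s : (x : M) → (Model m ≃L[ℝ] TangentSpace (𝓡 (m + 2)) x),
      (∀ x ∈ U, s x ∈ fibre x) ∧ ∀ w : Model m, SmoothVectorFieldOn (fun x => s x w) U

/-- The distribution `λ` of dimension one of a `GN`-structure, `λ_x = u(ℝk)` for `u` in the fibre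
over `x`. -/
def GStructure.lam {m : ℕ} {M : Type*} [TopologicalSpace M] [ChartedSpace (Model m) M]
    [IsManifold (𝓡 (m + 2)) ∞ M] (P : GStructure (GN m) M) (x : M) :
    Submodule ℝ (TangentSpace (𝓡 (m + 2)) x) :=
  Submodule.span ℝ {v | ∃ u ∈ P.fibre x, ∃ c : ℝ, v = u (c • vecK m)}

/-- The distribution `Λ` of codimension one of a `GN`-structure, `Λ_x = u({k}^⊥)` for `u` in the
fibre over `x`. -/
def GStructure.Lam {m : ℕ} {M : Type*} [TopologicalSpace M] [ChartedSpace (Model m) M]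
    [IsManifold (𝓡 (m + 2)) ∞ M] (P : GStructure (GN m) M) (x : M) :
    Submodule ℝ (TangentSpace (𝓡 (m + 2)) x) :=
  Submodule.span ℝ {v | ∃ u ∈ P.fibre x, ∃ w : Model m, eta (vecK m) w = 0 ∧ v = u w}

/-- The subspace `u(ℝk)` is the same for all frames `u` in the fibre. -/
theorem GStructure.lam_eq {m : ℕ} {M : Type*} [TopologicalSpace M] [ChartedSpace (Model m) M]
    [IsManifold (𝓡 (m + 2)) ∞ M] (P : GStructure (GN m) M) (x : M)
    (u : Model m ≃L[ℝ] TangentSpace (𝓡 (m + 2)) x) (hu : u ∈ P.fibre x) :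
    (P.lam x : Set (TangentSpace (𝓡 (m + 2)) x)) = {v | ∃ c : ℝ, v = u (c • vecK m)} := by
  apply Set.Subset.antisymm
  · intro v hv
    have hle : P.lam x ≤ Submodule.span ℝ {u (vecK m)} := by
      refine Submodule.span_le.2 ?_
      rintro _ ⟨u', hu', c, rfl⟩
      obtain ⟨a, ⟨⟨d, hd⟩, -, -⟩, rfl⟩ := P.transitive x u hu u' hu'
      refine Submodule.mem_span_singleton.2 ⟨c * d, ?_⟩
      change _ = u (a (c • vecK m))
      rw [map_smul, hd, map_smul, map_smul, smul_smul]
    obtain ⟨c, rfl⟩ := Submodule.mem_span_singleton.1 (hle hv)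
    exact ⟨c, (map_smul u c (vecK m)).symm⟩
  · rintro v ⟨c, rfl⟩
    exact Submodule.subset_span ⟨u, hu, c, rfl⟩

/-- The subspace `u({k}^⊥)` is the same for all frames `u` in the fibre. -/
theorem GStructure.Lam_eq {m : ℕ} {M : Type*} [TopologicalSpace M] [ChartedSpace (Model m) M]
    [IsManifold (𝓡 (m + 2)) ∞ M] (P : GStructure (GN m) M) (x : M)
    (u : Model m ≃L[ℝ] TangentSpace (𝓡 (m + 2)) x) (hu : u ∈ P.fibre x) :
    (P.Lam x : Set (TangentSpace (𝓡 (m + 2)) x)) =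
      {v | ∃ w : Model m, eta (vecK m) w = 0 ∧ v = u w} := by
  apply Set.Subset.antisymm
  · intro v hv
    induction hv using Submodule.span_induction with
    | mem v hv =>
      obtain ⟨u', hu', w, hw, rfl⟩ := hv
      obtain ⟨a, ⟨h1, -, h3⟩, rfl⟩ := P.transitive x u hu u' hu'
      exact ⟨a w, (GN_perp h1 h3 w).2 hw, rfl⟩
    | zero => exact ⟨0, by simp [eta], (map_zero u).symm⟩
    | add v v' _ _ hv hv' =>
      obtain ⟨w, hw, rfl⟩ := hv
      obtain ⟨w', hw', rfl⟩ := hv'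
      refine ⟨w + w', ?_, (map_add u w w').symm⟩
      simp [eta, vecK] at hw hw' ⊢
      simp [hw, hw']
    | smul c v _ hv =>
      obtain ⟨w, hw, rfl⟩ := hv
      refine ⟨c • w, ?_, (map_smul u c w).symm⟩
      simp [eta, vecK] at hw ⊢
      simp [hw]
  · rintro v ⟨w, hw, rfl⟩
    exact Submodule.subset_span ⟨u, hu, w, hw, rfl⟩

/-- `φ` is a local flow of `X`, a vector field on `U`: it is defined and smooth on
`(-ε, ε) × V`, takes values in `U`, and its orbits are integral curves of `X`. -/
structure IsLocalFlow {m : ℕ} {M : Type*} [TopologicalSpace M] [ChartedSpace (Model m) M]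
    [IsManifold (𝓡 (m + 2)) ∞ M]
    (X : (x : M) → TangentSpace (𝓡 (m + 2)) x) (U : Set M) (ε : ℝ) (V : Set M)
    (φ : ℝ → M → M) : Prop where
  smooth : ContMDiffOn (𝓘(ℝ, ℝ).prod (𝓡 (m + 2))) (𝓡 (m + 2)) ∞
    (fun q : ℝ × M => φ q.1 q.2) (Set.Ioo (-ε) ε ×ˢ V)
  mapsTo : ∀ t ∈ Set.Ioo (-ε) ε, ∀ y ∈ V, φ t y ∈ U
  zero : ∀ y ∈ V, φ 0 y = y
  integral : ∀ y ∈ V, IsMIntegralCurveOn (fun t => φ t y) X (Set.Ioo (-ε) ε)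

/-- `X`, a smooth vector field on the open set `U`, is a local infinitesimal automorphism of `P`:
the derivatives of its local flow map frames in `P` to frames in `P`. -/
def IsInfinitesimalAutomorphismOn {m : ℕ} {G : Subgroup (Model m ≃L[ℝ] Model m)}
    {M : Type*} [TopologicalSpace M] [ChartedSpace (Model m) M]
    [IsManifold (𝓡 (m + 2)) ∞ M] (P : GStructure G M)
    (X : (x : M) → TangentSpace (𝓡 (m + 2)) x) (U : Set M) : Prop :=
  ∀ p ∈ U, ∃ (ε : ℝ) (V : Set M) (φ : ℝ → M → M),
    0 < ε ∧ IsOpen V ∧ p ∈ V ∧ V ⊆ U ∧ IsLocalFlow X U ε V φ ∧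
    ∀ t ∈ Set.Ioo (-ε) ε, ∀ y ∈ V, ∀ u ∈ P.fibre y, ∃ u' ∈ P.fibre (φ t y),
      ∀ w : Model m, mfderiv (𝓡 (m + 2)) (𝓡 (m + 2)) (φ t) y (u w) = u' w

/-- A Kundt structure: a `GN`-structure such that `Λ` is integrable and around each point there is
a (nowhere vanishing) local vector field belonging to `λ` which is an infinitesimal automorphism. -/
def IsKundtStructure {m : ℕ} {M : Type*} [TopologicalSpace M] [ChartedSpace (Model m) M]
    [IsManifold (𝓡 (m + 2)) ∞ M] (P : GStructure (GN m) M) : Prop :=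
  IsIntegrable P.Lam ∧
  ∀ p : M, ∃ (U : Set M) (X : (x : M) → TangentSpace (𝓡 (m + 2)) x),
    IsOpen U ∧ p ∈ U ∧ SmoothVectorFieldOn X U ∧
    (∀ x ∈ U, X x ∈ P.lam x ∧ X x ≠ 0) ∧ IsInfinitesimalAutomorphismOn P X U

/-! ### Lorentzian metrics -/

/-- A smooth Lorentzian metric on `M`. -/
structure LorentzMetric (m : ℕ) (M : Type*) [TopologicalSpace M] [ChartedSpace (Model m) M]
    [IsManifold (𝓡 (m + 2)) ∞ M] where
  /-- the bilinear form on the tangent space at `x` -/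
  val : (x : M) →
    TangentSpace (𝓡 (m + 2)) x →L[ℝ] TangentSpace (𝓡 (m + 2)) x →L[ℝ] ℝ
  symm : ∀ (x : M) (v w : TangentSpace (𝓡 (m + 2)) x), val x v w = val x w v
  /-- the tangent space at `x` is isometric to Minkowski space -/
  lorentzian : ∀ x : M, ∃ u : Model m ≃L[ℝ] TangentSpace (𝓡 (m + 2)) x,
    ∀ v w : Model m, val x (u v) (u w) = eta v w
  smooth : ContMDiff (𝓡 (m + 2))
    ((𝓡 (m + 2)).prod 𝓘(ℝ, Model m →L[ℝ] Model m →L[ℝ] ℝ)) ∞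
    (fun x => Bundle.TotalSpace.mk' (Model m →L[ℝ] Model m →L[ℝ] ℝ)
      (E := fun x : M =>
        TangentSpace (𝓡 (m + 2)) x →L[ℝ] TangentSpace (𝓡 (m + 2)) x →L[ℝ] ℝ) x (val x))

/-- The metric `g` belongs to the `GN`-structure `P` if it is determined by a
`Sim(n - 2)`-subprincipal bundle `Q` of `P`, i.e. the elements of `Q` are null frames for `g`. -/
def LorentzMetric.BelongsTo {m : ℕ} {M : Type*} [TopologicalSpace M] [ChartedSpace (Model m) M]
    [IsManifold (𝓡 (m + 2)) ∞ M] (g : LorentzMetric m M) (P : GStructure (GN m) M) : Prop :=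
  ∃ Q : GStructure (Sim m) M, ∀ x : M, Q.fibre x ⊆ P.fibre x ∧
    ∀ u ∈ Q.fibre x, ∀ v w : Model m, g.val x (u v) (u w) = eta v w

/-- The bilinear form of `g` at `x`. -/
def LorentzMetric.form {m : ℕ} {M : Type*} [TopologicalSpace M] [ChartedSpace (Model m) M]
    [IsManifold (𝓡 (m + 2)) ∞ M] (g : LorentzMetric m M) (x : M) :
    LinearMap.BilinForm ℝ (TangentSpace (𝓡 (m + 2)) x) :=
  LinearMap.mk₂ ℝ (fun v w => g.val x v w) (by simp) (by simp) (by simp) (by simp)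

theorem eta_nondegenerate {m : ℕ} (v : Model m) (h : ∀ w, eta v w = 0) : v = 0 := by
  ext i
  refine Fin.cases ?_ (fun j => Fin.cases ?_ (fun k => ?_) j) i
  · simpa [eta, Fin.ext_iff] using h (EuclideanSpace.single 1 1)
  · simpa [eta, Fin.ext_iff] using h (EuclideanSpace.single 0 1)
  · have := h (EuclideanSpace.single k.succ.succ 1)
    have h1 : (1 : Fin (m + 2)) ≠ k.succ.succ := by simp [Fin.ext_iff]
    simpa [eta, Pi.single_apply, Fin.succ_inj, h1] using this

theorem LorentzMetric.form_nondegenerate {m : ℕ} {M : Type*} [TopologicalSpace M]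
    [ChartedSpace (Model m) M] [IsManifold (𝓡 (m + 2)) ∞ M] (g : LorentzMetric m M) (x : M) :
    (g.form x).Nondegenerate := by
  obtain ⟨u, hu⟩ := g.lorentzian x
  have key : ∀ v, (∀ w, g.val x v w = 0) → v = 0 := fun v hv => by
    have h0 : u.symm v = 0 := eta_nondegenerate _ fun w => by
      rw [← hu, u.apply_symm_apply, hv]
    exact (u.symm.map_eq_zero_iff).1 h0
  exact ⟨fun v hv => key v hv, fun w hw => key w fun v => by rw [g.symm]; exact hw v⟩

/-- The full contraction `S_{ab} T^{ab}` of two bilinear forms on the tangent space at `x`, with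
indices raised by means of `g`: if `(b_i)` is a basis and `(b^i)` is its `g`-dual basis,
`g(b^i, b_j) = δ_{ij}`, it is `∑ S(b_i, b_j) T(b^i, b^j)`. It does not depend on the basis. -/
def LorentzMetric.contract {m : ℕ} {M : Type*} [TopologicalSpace M] [ChartedSpace (Model m) M]
    [IsManifold (𝓡 (m + 2)) ∞ M] (g : LorentzMetric m M) (x : M)
    (S T : TangentSpace (𝓡 (m + 2)) x → TangentSpace (𝓡 (m + 2)) x → ℝ) : ℝ :=
  letI : FiniteDimensional ℝ (TangentSpace (𝓡 (m + 2)) x) :=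
    inferInstanceAs (FiniteDimensional ℝ (Model m))
  let b := Module.finBasis ℝ (TangentSpace (𝓡 (m + 2)) x)
  let b' := LinearMap.BilinForm.dualBasis (g.form x) (g.form_nondegenerate x) b
  ∑ i, ∑ j, S (b i) (b j) * T (b' i) (b' j)

/-- The orthogonal complement of a field of tangent subspaces. -/
def LorentzMetric.perp {m : ℕ} {M : Type*} [TopologicalSpace M] [ChartedSpace (Model m) M]
    [IsManifold (𝓡 (m + 2)) ∞ M] (g : LorentzMetric m M)
    (D : (x : M) → Submodule ℝ (TangentSpace (𝓡 (m + 2)) x)) (x : M) :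
    Submodule ℝ (TangentSpace (𝓡 (m + 2)) x) :=
  (g.form x).orthogonal (D x)

/-- `D` is a null distribution of `(M, g)`: a smooth distribution of dimension one which consists
of null vectors. -/
def LorentzMetric.IsNullDistribution {m : ℕ} {M : Type*} [TopologicalSpace M]
    [ChartedSpace (Model m) M] [IsManifold (𝓡 (m + 2)) ∞ M] (g : LorentzMetric m M)
    (D : (x : M) → Submodule ℝ (TangentSpace (𝓡 (m + 2)) x)) : Prop :=
  (∀ p : M, ∃ (U : Set M) (X : (x : M) → TangentSpace (𝓡 (m + 2)) x),
    IsOpen U ∧ p ∈ U ∧ SmoothVectorFieldOn X U ∧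
    ∀ x ∈ U, X x ≠ 0 ∧ D x = Submodule.span ℝ {X x}) ∧
  ∀ (x : M), ∀ v ∈ D x, g.val x v v = 0

/-- `cov` is the Levi-Civita connection of `g`: it is torsion-free and compatible with `g`. Here
`cov Y x v` is `∇_v Y`. -/
def LorentzMetric.IsLeviCivita {m : ℕ} {M : Type*} [TopologicalSpace M]
    [ChartedSpace (Model m) M] [IsManifold (𝓡 (m + 2)) ∞ M] (g : LorentzMetric m M)
    (cov : CovariantDerivative (𝓡 (m + 2)) (Model m)
      (fun x : M => TangentSpace (𝓡 (m + 2)) x)) : Prop :=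
  cov.torsion = 0 ∧
  ∀ (x : M) (Y Z : (x : M) → TangentSpace (𝓡 (m + 2)) x),
    MDifferentiableAt (𝓡 (m + 2)) (𝓡 (m + 2)).tangent
      (fun y => (⟨y, Y y⟩ : TangentBundle (𝓡 (m + 2)) M)) x →
    MDifferentiableAt (𝓡 (m + 2)) (𝓡 (m + 2)).tangent
      (fun y => (⟨y, Z y⟩ : TangentBundle (𝓡 (m + 2)) M)) x →
    ∀ v : TangentSpace (𝓡 (m + 2)) x,
      mvfderiv (𝓡 (m + 2)) (fun y => g.val y (Y y) (Z y)) x v =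
        g.val x (cov Y x v) (Z x) + g.val x (Y x) (cov Z x v)

/-- The vector field `X` is affinely geodesic, shear-free and divergence-free on `U`, where `cov`
is the Levi-Civita connection of `g`:
`∇_X X = 0`, `∇_{(a} X_{b)} ∇^a X^b = 0` and `∇_a X^a = 0`. -/
def LorentzMetric.IsGeodesicShearDivFreeOn {m : ℕ} {M : Type*} [TopologicalSpace M]
    [ChartedSpace (Model m) M] [IsManifold (𝓡 (m + 2)) ∞ M] (g : LorentzMetric m M)
    (cov : CovariantDerivative (𝓡 (m + 2)) (Model m)
      (fun x : M => TangentSpace (𝓡 (m + 2)) x))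
    (X : (x : M) → TangentSpace (𝓡 (m + 2)) x) (U : Set M) : Prop :=
  ∀ x ∈ U,
    cov X x (X x) = 0 ∧
    g.contract x
      (fun v w => (g.val x (cov X x v) w + g.val x (cov X x w) v) / 2)
      (fun v w => g.val x (cov X x v) w) = 0 ∧
    LinearMap.trace ℝ (TangentSpace (𝓡 (m + 2)) x) (cov X x).toLinearMap = 0

/-- `(M, g, D)` is a Kundt spacetime: `D` is a null distribution, its orthogonal complement is
integrable, and around each point there is a (nowhere vanishing) local vector field belonging to
`D` which is affinely geodesic, shear-free and divergence-free. -/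
def LorentzMetric.IsKundtSpacetime {m : ℕ} {M : Type*} [TopologicalSpace M]
    [ChartedSpace (Model m) M] [IsManifold (𝓡 (m + 2)) ∞ M] (g : LorentzMetric m M)
    (D : (x : M) → Submodule ℝ (TangentSpace (𝓡 (m + 2)) x)) : Prop :=
  g.IsNullDistribution D ∧ IsIntegrable (g.perp D) ∧
  ∃ cov : CovariantDerivative (𝓡 (m + 2)) (Model m)
      (fun x : M => TangentSpace (𝓡 (m + 2)) x),
    g.IsLeviCivita cov ∧
    ∀ p : M, ∃ (U : Set M) (X : (x : M) → TangentSpace (𝓡 (m + 2)) x),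
      IsOpen U ∧ p ∈ U ∧ SmoothVectorFieldOn X U ∧ (∀ x ∈ U, X x ∈ D x ∧ X x ≠ 0) ∧
      g.IsGeodesicShearDivFreeOn cov X U

end Kundt

end

/-! A frame of `P` differs from a null frame of `g` by an element of `GN`, and such elements
preserve η on {k}^⊥ × {k}^⊥ and on ℝk × ℝⁿ. Hence every frame of `P`, not only those of the
`Sim`-reduction, identifies the restrictions of `g` to Λ × Λ and to λ × TM with those of η
(`BelongsTo.val_perp`, `BelongsTo.val_vecK`). So λ is null and λ^⊥ = Λ, which is integrable by
hypothesis.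

Let X be an infinitesimal automorphism belonging to λ. Its flow maps frames of `P` to frames of `P`,
so it preserves these two restrictions, and the Lie derivative S(v, w) = g(∇_v X, w) + g(v, ∇_w X)
vanishes on Λ × Λ and on λ × TM (`val_cov_add_val_cov_eq_zero`). The three conditions on X are then
pointwise. Geodesic: S(X, z) = 0 gives g(∇_X X, z) = -g(X, ∇_z X) = -½ z(g(X, X)) = 0. Shear-free:
vanishing on Λ × Λ forces S to be a symmetric product of g(K, ·), with K spanning λ, and another
covector; its contraction with ∇X is a value of S on λ × TM (`contract_eq_zero`). Divergence-free:
in a null frame the trace of ∇X involves only S(k, l) and S(mᵢ, mᵢ) (`trace_eq_zero_of_eta`).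

The analytic input is twofold: a Levi-Civita connection, constructed from Koszul's formula, and the
identity expressing S as the derivative at t = 0 of g(dφ_t v, dφ_t w) (`hasDerivAt_val_flow`). The
latter is computed in a chart and rests on the symmetry of second derivatives of the flow. -/

open scoped Topology

noncomputable section

open VectorField FiberBundle

namespace Kundt

section

variable {m : ℕ} {M : Type*} [TopologicalSpace M] [ChartedSpace (Model m) M]
  [IsManifold (𝓡 (m + 2)) ∞ M]

/-! ### Existence of the Levi-Civita connection -/

/-- `Y` is a vector field differentiable at `x`. -/
abbrev DiffVectorFieldAt (Y : (x : M) → TangentSpace (𝓡 (m + 2)) x) (x : M) : Prop :=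
  MDifferentiableAt (𝓡 (m + 2)) (𝓡 (m + 2)).tangent
    (fun y => (⟨y, Y y⟩ : TangentBundle (𝓡 (m + 2)) M)) x

namespace LorentzMetric

variable (g : LorentzMetric m M)

theorem mdifferentiableAt_val {x : M} {Y Z : (x : M) → TangentSpace (𝓡 (m + 2)) x}
    (hY : DiffVectorFieldAt Y x) (hZ : DiffVectorFieldAt Z x) :
    MDifferentiableAt (𝓡 (m + 2)) 𝓘(ℝ, ℝ) (fun y => g.val y (Y y) (Z y)) x := by
  have h := (g.smooth x).mdifferentiableAt (by simp)
  have := MDifferentiableAt.clm_bundle_apply₂ (E₃ := Bundle.Trivial M ℝ) (F₃ := ℝ) h hY hZ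
  rw [mdifferentiableAt_totalSpace] at this
  simpa using this.2

theorem ext_of_val {x : M} {v w : TangentSpace (𝓡 (m + 2)) x}
    (h : ∀ z, g.val x v z = g.val x w z) : v = w := by
  rw [← sub_eq_zero]
  exact (g.form_nondegenerate x).1 _ fun z => by
    change g.val x (v - w) z = 0
    rw [map_sub, sub_apply, h, sub_self]

/-- The right-hand side of Koszul's formula for `2 g(∇_V Y, Z)`. -/
def koszul (Y V Z : (x : M) → TangentSpace (𝓡 (m + 2)) x) (x : M) : ℝ :=
  mvfderiv (𝓡 (m + 2)) (fun y => g.val y (Y y) (Z y)) x (V x) +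
  mvfderiv (𝓡 (m + 2)) (fun y => g.val y (V y) (Z y)) x (Y x) -
  mvfderiv (𝓡 (m + 2)) (fun y => g.val y (V y) (Y y)) x (Z x) +
  g.val x (mlieBracket (𝓡 (m + 2)) V Y x) (Z x) -
  g.val x (mlieBracket (𝓡 (m + 2)) V Z x) (Y x) -
  g.val x (mlieBracket (𝓡 (m + 2)) Y Z x) (V x)

variable {g}

/-- The product rule and the brackets both produce derivatives of `f`, and these cancel. The same
happens in the `V` slot, so the expression is tensorial in `V` and `Z` and depends only on their
values at `x`. -/
theorem koszul_smul_right {Y V Z : (x : M) → TangentSpace (𝓡 (m + 2)) x} {f : M → ℝ} {x : M}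
    (hY : DiffVectorFieldAt Y x) (hV : DiffVectorFieldAt V x) (hZ : DiffVectorFieldAt Z x)
    (hf : MDifferentiableAt (𝓡 (m + 2)) 𝓘(ℝ, ℝ) f x) :
    g.koszul Y V (f • Z) x = f x * g.koszul Y V Z x := by
  simp only [koszul, Pi.smul_apply', map_smul, smul_eq_mul]
  rw [mvfderiv_fun_mul hf (g.mdifferentiableAt_val hY hZ),
    mvfderiv_fun_mul hf (g.mdifferentiableAt_val hV hZ),
    mlieBracket_smul_right hf hZ, mlieBracket_smul_right hf hZ, g.symm x _ (Y x),
    g.symm x (_ + _) (V x), g.symm x (mlieBracket _ V Z x), g.symm x (mlieBracket _ Y Z x),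
    g.symm x (mlieBracket _ V Y x)]
  simp only [map_add, map_smul, add_apply, smul_apply,
    smul_eq_mul]
  rw [g.symm x (Y x) (Z x), g.symm x (V x) (Z x)]
  ring

theorem koszul_smul_middle {Y V Z : (x : M) → TangentSpace (𝓡 (m + 2)) x} {f : M → ℝ} {x : M}
    (hY : DiffVectorFieldAt Y x) (hV : DiffVectorFieldAt V x) (hZ : DiffVectorFieldAt Z x)
    (hf : MDifferentiableAt (𝓡 (m + 2)) 𝓘(ℝ, ℝ) f x) :
    g.koszul Y (f • V) Z x = f x * g.koszul Y V Z x := by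
  simp only [koszul, Pi.smul_apply', map_smul, smul_eq_mul, smul_apply]
  rw [mvfderiv_fun_mul hf (g.mdifferentiableAt_val hV hZ),
    mvfderiv_fun_mul hf (g.mdifferentiableAt_val hV hY),
    mlieBracket_smul_left hf hV, mlieBracket_smul_left hf hV]
  simp only [map_add, map_smul, add_apply, smul_apply,
    smul_eq_mul]
  ring

/-- In the differentiated slot the derivatives of `f` along `Z` cancel, while those along `V` add
up. After halving, the surviving term is the Leibniz term of a covariant derivative. -/
theorem koszul_smul_left {Y V Z : (x : M) → TangentSpace (𝓡 (m + 2)) x} {f : M → ℝ} {x : M}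
    (hY : DiffVectorFieldAt Y x) (hV : DiffVectorFieldAt V x) (hZ : DiffVectorFieldAt Z x)
    (hf : MDifferentiableAt (𝓡 (m + 2)) 𝓘(ℝ, ℝ) f x) :
    g.koszul (f • Y) V Z x = f x * g.koszul Y V Z x +
      2 * (mvfderiv (𝓡 (m + 2)) f x (V x) * g.val x (Y x) (Z x)) := by
  simp only [koszul, Pi.smul_apply', map_smul, smul_eq_mul, smul_apply]
  rw [mvfderiv_fun_mul hf (g.mdifferentiableAt_val hY hZ),
    mvfderiv_fun_mul hf (g.mdifferentiableAt_val hV hY),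
    mlieBracket_smul_left hf hY, mlieBracket_smul_right hf hY]
  simp only [map_add, map_smul, add_apply, smul_apply,
    smul_eq_mul]
  rw [g.symm x (Y x) (V x)]
  ring

theorem koszul_add_right {Y V Z Z' : (x : M) → TangentSpace (𝓡 (m + 2)) x} {x : M}
    (hY : DiffVectorFieldAt Y x) (hV : DiffVectorFieldAt V x) (hZ : DiffVectorFieldAt Z x)
    (hZ' : DiffVectorFieldAt Z' x) :
    g.koszul Y V (Z + Z') x = g.koszul Y V Z x + g.koszul Y V Z' x := by
  simp only [koszul, Pi.add_apply, map_add]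
  rw [mvfderiv_fun_add (g.mdifferentiableAt_val hY hZ) (g.mdifferentiableAt_val hY hZ'),
    mvfderiv_fun_add (g.mdifferentiableAt_val hV hZ) (g.mdifferentiableAt_val hV hZ'),
    mlieBracket_add_right hZ hZ', mlieBracket_add_right hZ hZ']
  simp only [map_add, add_apply]
  ring

theorem koszul_add_middle {Y V V' Z : (x : M) → TangentSpace (𝓡 (m + 2)) x} {x : M}
    (hY : DiffVectorFieldAt Y x) (hV : DiffVectorFieldAt V x) (hV' : DiffVectorFieldAt V' x)
    (hZ : DiffVectorFieldAt Z x) :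
    g.koszul Y (V + V') Z x = g.koszul Y V Z x + g.koszul Y V' Z x := by
  simp only [koszul, Pi.add_apply, map_add, add_apply]
  rw [mvfderiv_fun_add (g.mdifferentiableAt_val hV hZ) (g.mdifferentiableAt_val hV' hZ),
    mvfderiv_fun_add (g.mdifferentiableAt_val hV hY) (g.mdifferentiableAt_val hV' hY),
    mlieBracket_add_left hV hV', mlieBracket_add_left hV hV']
  simp only [map_add, add_apply]
  ring

theorem koszul_add_left {Y Y' V Z : (x : M) → TangentSpace (𝓡 (m + 2)) x} {x : M}
    (hY : DiffVectorFieldAt Y x) (hY' : DiffVectorFieldAt Y' x) (hV : DiffVectorFieldAt V x)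
    (hZ : DiffVectorFieldAt Z x) :
    g.koszul (Y + Y') V Z x = g.koszul Y V Z x + g.koszul Y' V Z x := by
  simp only [koszul, Pi.add_apply, map_add, add_apply]
  rw [mvfderiv_fun_add (g.mdifferentiableAt_val hY hZ) (g.mdifferentiableAt_val hY' hZ),
    mvfderiv_fun_add (g.mdifferentiableAt_val hV hY) (g.mdifferentiableAt_val hV hY'),
    mlieBracket_add_left hY hY', mlieBracket_add_right hY hY']
  simp only [map_add, add_apply]
  ring

variable (g)

/-- Koszul's formula as a bilinear form. -/
def koszulForm (Y : (x : M) → TangentSpace (𝓡 (m + 2)) x) (x : M) (hY : DiffVectorFieldAt Y x) :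
    TangentSpace (𝓡 (m + 2)) x →L[ℝ] TangentSpace (𝓡 (m + 2)) x →L[ℝ] ℝ :=
  TensorialAt.mkHom₂ (I := 𝓡 (m + 2)) (F := Model m) (F' := Model m)
    (fun V Z => g.koszul Y V Z x) x
    (fun _ hZ => ⟨fun hf hV => koszul_smul_middle hY hV hZ hf,
      fun hV hV' => koszul_add_middle hY hV hV' hZ⟩)
    (fun _ hV => ⟨fun hf hZ => koszul_smul_right hY hV hZ hf,
      fun hZ hZ' => koszul_add_right hY hV hZ hZ'⟩)

theorem koszulForm_apply {Y V Z : (x : M) → TangentSpace (𝓡 (m + 2)) x} {x : M}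
    (hY : DiffVectorFieldAt Y x) (hV : DiffVectorFieldAt V x) (hZ : DiffVectorFieldAt Z x) :
    g.koszulForm Y x hY (V x) (Z x) = g.koszul Y V Z x :=
  TensorialAt.mkHom₂_apply _ _ hV hZ

/-- A bilinear form `B` on the tangent space at `x` as an endomorphism: `g(A v, w) = B(v, w)`. -/
theorem exists_raise (x : M)
    (B : TangentSpace (𝓡 (m + 2)) x →L[ℝ] TangentSpace (𝓡 (m + 2)) x →L[ℝ] ℝ) :
    ∃ A : TangentSpace (𝓡 (m + 2)) x →L[ℝ] TangentSpace (𝓡 (m + 2)) x,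
      ∀ v w, g.val x (A v) w = B v w := by
  have : FiniteDimensional ℝ (TangentSpace (𝓡 (m + 2)) x) :=
    inferInstanceAs (FiniteDimensional ℝ (Model m))
  have : T2Space (TangentSpace (𝓡 (m + 2)) x) := inferInstanceAs (T2Space (Model m))
  let D := (g.form x).toDual (g.form_nondegenerate x)
  let L : TangentSpace (𝓡 (m + 2)) x →ₗ[ℝ] Module.Dual ℝ (TangentSpace (𝓡 (m + 2)) x) :=
    { toFun := fun v => (B v).toLinearMap
      map_add' := fun v w => by ext; simp
      map_smul' := fun c v => by ext; simp }
  refine ⟨LinearMap.toContinuousLinearMap (D.symm.toLinearMap ∘ₗ L), fun v w => ?_⟩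
  change g.form x (D.symm (L v)) w = L v w
  rw [← LinearMap.BilinForm.toDual_def (B := g.form x) (b := g.form_nondegenerate x)]
  rw [LinearEquiv.apply_symm_apply]

open Classical in
/-- The Levi-Civita derivative `v ↦ ∇_v Y`, defined by Koszul's formula. -/
def leviCivitaFun (Y : (x : M) → TangentSpace (𝓡 (m + 2)) x) (x : M) :
    TangentSpace (𝓡 (m + 2)) x →L[ℝ] TangentSpace (𝓡 (m + 2)) x :=
  if hY : DiffVectorFieldAt Y x then (2⁻¹ : ℝ) • (g.exists_raise x (g.koszulForm Y x hY)).choose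
  -- The value here is immaterial: the axioms of a covariant derivative are tested only on sections
  -- differentiable at the point.
  else 0

theorem val_leviCivitaFun {Y V Z : (x : M) → TangentSpace (𝓡 (m + 2)) x} {x : M}
    (hY : DiffVectorFieldAt Y x) (hV : DiffVectorFieldAt V x) (hZ : DiffVectorFieldAt Z x) :
    g.val x (g.leviCivitaFun Y x (V x)) (Z x) = g.koszul Y V Z x / 2 := by
  have h := (g.exists_raise x (g.koszulForm Y x hY)).choose_spec (V x) (Z x)
  rw [leviCivitaFun, dif_pos hY, smul_apply, map_smul,
    smul_apply, h, koszulForm_apply g hY hV hZ, smul_eq_mul]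
  ring

theorem diffVectorFieldAt_extend {x : M} (v : TangentSpace (𝓡 (m + 2)) x) :
    DiffVectorFieldAt (extend (Model m) v) x :=
  mdifferentiableAt_extend ..

/-- The Levi-Civita connection of `g`. -/
def leviCivita : CovariantDerivative (𝓡 (m + 2)) (Model m)
    (fun x : M => TangentSpace (𝓡 (m + 2)) x) where
  toFun := g.leviCivitaFun
  isCovariantDerivativeOnUniv :=
    { add := by
        intro Y Y' x hY hY' _
        ext1 v
        refine g.ext_of_val fun z => ?_
        have hv := diffVectorFieldAt_extend v
        have hz := diffVectorFieldAt_extend z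
        have h1 := g.val_leviCivitaFun (mdifferentiableAt_add_section hY hY') hv hz
        have h2 := g.val_leviCivitaFun hY hv hz
        have h3 := g.val_leviCivitaFun hY' hv hz
        rw [extend_apply_self, extend_apply_self] at h1 h2 h3
        rw [add_apply, map_add, add_apply, h2, h3]
        refine h1.trans ?_
        rw [koszul_add_left hY hY' hv hz]
        ring
      leibniz := by
        intro Y f x hY hf _
        ext1 v
        refine g.ext_of_val fun z => ?_
        have hv := diffVectorFieldAt_extend v
        have hz := diffVectorFieldAt_extend z
        have h1 := g.val_leviCivitaFun (hf.smul_section hY) hv hz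
        have h2 := g.val_leviCivitaFun hY hv hz
        rw [extend_apply_self, extend_apply_self] at h1 h2
        rw [add_apply, map_add, add_apply,
          smul_apply, map_smul, smul_apply, h2,
          ContinuousLinearMap.smulRight_apply, map_smul, smul_apply]
        refine h1.trans ?_
        rw [koszul_smul_left hY hv hz hf, extend_apply_self, extend_apply_self, smul_eq_mul,
          smul_eq_mul]
        ring }

/-- Antisymmetrising Koszul's expression in `Y` and `V` leaves 2 g([V, Y], Z), which gives zero
torsion; symmetrising it in `Y` and `Z` leaves 2 V(g(Y, Z)), which gives compatibility with `g`. -/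
theorem isLeviCivita_leviCivita : g.IsLeviCivita g.leviCivita := by
  constructor
  · refine (CovariantDerivative.torsion_eq_zero_iff _).2 ?_
    intro V Y x hV hY
    refine g.ext_of_val fun z => ?_
    have hz := diffVectorFieldAt_extend z
    have h1 := g.val_leviCivitaFun hY hV hz
    have h2 := g.val_leviCivitaFun hV hY hz
    rw [extend_apply_self] at h1 h2
    rw [map_sub, sub_apply]
    refine (congrArg₂ _ h1 h2).trans ?_
    have h3 : (fun y => g.val y (V y) (Y y)) = fun y => g.val y (Y y) (V y) :=
      funext fun y => g.symm y _ _
    rw [koszul, koszul, h3, mlieBracket_swap_apply (V := Y) (W := V), extend_apply_self, map_neg,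
      neg_apply]
    ring
  · intro x Y Z hY hZ v
    have hv := diffVectorFieldAt_extend v
    have h1 := g.val_leviCivitaFun hY hv hZ
    have h2 := g.val_leviCivitaFun hZ hv hY
    rw [extend_apply_self] at h1 h2
    rw [g.symm x (Y x)]
    refine Eq.trans ?_ (congrArg₂ _ h1 h2).symm
    have h3 : (fun y => g.val y (Z y) (Y y)) = fun y => g.val y (Y y) (Z y) :=
      funext fun y => g.symm y _ _
    rw [koszul, koszul, h3, mlieBracket_swap_apply (V := Z) (W := Y), extend_apply_self, map_neg,
      neg_apply]
    ring

end LorentzMetric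

end

/-! ### Calculus in a chart -/

section

/-- Mixed partial derivatives commute: if `X` is the time derivative at time zero of a
family `F` of maps, the time derivative of the spatial derivative of `F` is the derivative of `X`. -/
theorem hasDerivAt_fderiv_of_partial {E : Type*} [NormedAddCommGroup E] [NormedSpace ℝ E]
    {F : ℝ × E → E} {a : E} (hF : ContDiffAt ℝ 2 F (0, a)) {X : E → E}
    (hX : ∀ᶠ b in 𝓝 a, fderiv ℝ F (0, b) (1, 0) = X b) (v : E) :
    HasDerivAt (fun t : ℝ => fderiv ℝ F (t, a) (0, v)) (fderiv ℝ X a v) 0 := by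
  have hD : HasFDerivAt (fderiv ℝ F) (fderiv ℝ (fderiv ℝ F) (0, a)) (0, a) :=
    ((hF.fderiv_right (m := 1) (by norm_num)).differentiableAt (by simp)).hasFDerivAt
  have h1 : HasDerivAt (fun t : ℝ => fderiv ℝ F (t, a))
      (fderiv ℝ (fderiv ℝ F) (0, a) (1, 0)) 0 :=
    hD.comp_hasDerivAt (0 : ℝ) ((hasDerivAt_id (0 : ℝ)).prodMk (hasDerivAt_const 0 a))
  have h2 : HasFDerivAt (fun b : E => fderiv ℝ F (0, b))
      ((fderiv ℝ (fderiv ℝ F) (0, a)).comp (ContinuousLinearMap.inr ℝ ℝ E)) a :=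
    hD.comp a (hasFDerivAt_prodMk_right (0 : ℝ) a)
  have h3 := (h2.clm_apply (hasFDerivAt_const ((1 : ℝ), (0 : E)) a)).congr_of_eventuallyEq
    (hX.mono fun b hb => hb.symm)
  have h4 := h1.clm_apply (hasDerivAt_const (0 : ℝ) ((0 : ℝ), v))
  have hs : IsSymmSndFDerivAt ℝ F (0, a) := hF.isSymmSndFDerivAt (by simp)
  rw [h3.fderiv]
  refine h4.congr_deriv ?_
  simpa using (hs (0, v) (1, 0)).symm

/-- A family of linear maps on Euclidean space is differentiable if it is so pointwise. -/
theorem hasDerivAt_clm {G : Type*} [NormedAddCommGroup G] [NormedSpace ℝ G] {n : ℕ}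
    {L : ℝ → EuclideanSpace ℝ (Fin n) →L[ℝ] G} {L' : EuclideanSpace ℝ (Fin n) →L[ℝ] G} {t : ℝ}
    (hL : ∀ v, HasDerivAt (fun s => L s v) (L' v) t) : HasDerivAt L L' t := by
  have hrep : ∀ B : EuclideanSpace ℝ (Fin n) →L[ℝ] G,
      B = ∑ i : Fin n, ContinuousLinearMap.smulRightL ℝ (EuclideanSpace ℝ (Fin n)) G
        (EuclideanSpace.proj i) (B (EuclideanSpace.single i 1)) := by
    intro B
    ext v
    have hv : v = ∑ i, v i • EuclideanSpace.single i (1 : ℝ) := by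
      simpa using ((EuclideanSpace.basisFun (Fin n) ℝ).sum_repr v).symm
    conv_lhs => rw [hv]
    simp
  have h : HasDerivAt (fun s => ∑ i : Fin n,
      ContinuousLinearMap.smulRightL ℝ (EuclideanSpace ℝ (Fin n)) G
        (EuclideanSpace.proj i) (L s (EuclideanSpace.single i 1)))
      (∑ i : Fin n, ContinuousLinearMap.smulRightL ℝ (EuclideanSpace ℝ (Fin n)) G
        (EuclideanSpace.proj i) (L' (EuclideanSpace.single i 1))) t :=
    HasDerivAt.fun_sum fun i _ =>
      (ContinuousLinearMap.hasFDerivAt _).comp_hasDerivAt t (hL (EuclideanSpace.single i 1))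
  rw [← hrep L'] at h
  exact h.congr_of_eventuallyEq (Filter.Eventually.of_forall fun s => hrep (L s))

/-- Near `p`, the extension of a tangent vector at `p` has constant components in the chart
at `p`. -/
theorem extend_eq_mfderivWithin {E H M : Type*} [NormedAddCommGroup E] [NormedSpace ℝ E]
    [TopologicalSpace H] {I : ModelWithCorners ℝ E H} [TopologicalSpace M] [ChartedSpace H M]
    [IsManifold I 1 M] {p z : M} (hz : z ∈ (chartAt H p).source) (v : TangentSpace I p) :
    extend E v z = mfderivWithin 𝓘(ℝ, E) I (extChartAt I p).symm
      (Set.range I) (extChartAt I p z) v := by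
  have hp : p ∈ (trivializationAt E (TangentSpace I) p).baseSet :=
    mem_baseSet_trivializationAt' p
  have h1 : (trivializationAt E (TangentSpace I) p ⟨p, v⟩).2 = v := by
    have h2 : (trivializationAt E (TangentSpace I) p).continuousLinearMapAt ℝ p v =
        (trivializationAt E (TangentSpace I) p ⟨p, v⟩).2 := by
      rw [Bundle.Trivialization.continuousLinearMapAt_apply,
        Bundle.Trivialization.linearMapAt_apply, if_pos hp]
    rw [← h2, TangentBundle.continuousLinearMapAt_trivializationAt (mem_chart_source _ p)]
    exact DFunLike.congr_fun (mfderiv_extChartAt_self (I := I) (x := p)) v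
  have h2 := Bundle.Trivialization.symmL_apply (R := ℝ)
    (trivializationAt E (TangentSpace I) p) (b := z) (by exact hz)
    (trivializationAt E (TangentSpace I) p ⟨p, v⟩).2
  refine h2.symm.trans ?_
  rw [h1]
  exact DFunLike.congr_fun (TangentBundle.symmL_trivializationAt (I := I) hz) v

theorem fderiv_sub_fderiv_of_eventuallyEq_const {E : Type*} [NormedAddCommGroup E]
    [NormedSpace ℝ E] {A B : E → E} {x v : E} (hB : B =ᶠ[𝓝 x] fun _ => v) :
    fderiv ℝ B x (A x) - fderiv ℝ A x (B x) = -fderiv ℝ A x v := by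
  rw [hB.fderiv_eq, hB.self_of_nhds]
  simp

variable {m : ℕ} {M : Type*} [TopologicalSpace M] [ChartedSpace (Model m) M]
  [IsManifold (𝓡 (m + 2)) ∞ M]

/-- The extension is a constant field in the chart at `p`, so only the derivative of the coordinate
expression of `X` survives in the bracket. The differential of that chart at `p` itself is the
identity, so no change of frame appears. -/
theorem mlieBracket_extend {X : (x : M) → TangentSpace (𝓡 (m + 2)) x} {p : M}
    (v : TangentSpace (𝓡 (m + 2)) p) :
    mlieBracket (𝓡 (m + 2)) X (extend (Model m) v) p =
      -fderiv ℝ (mpullbackWithin 𝓘(ℝ, Model m) (𝓡 (m + 2)) (extChartAt (𝓡 (m + 2)) p).symm X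
        (Set.range (𝓡 (m + 2)))) (extChartAt (𝓡 (m + 2)) p p) v := by
  have hV : mpullbackWithin 𝓘(ℝ, Model m) (𝓡 (m + 2)) (extChartAt (𝓡 (m + 2)) p).symm
      (extend (Model m) v) (Set.range (𝓡 (m + 2))) =ᶠ[𝓝 (extChartAt (𝓡 (m + 2)) p p)]
      fun _ => v := by
    filter_upwards [extChartAt_target_mem_nhds (I := 𝓡 (m + 2)) p] with a ha
    rw [mpullbackWithin_apply, extend_eq_mfderivWithin
      (by simpa using (extChartAt (𝓡 (m + 2)) p).map_target ha),
      (extChartAt (𝓡 (m + 2)) p).right_inv ha]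
    exact (isInvertible_mfderivWithin_extChartAt_symm ha).inverse_apply_eq.2 rfl
  have hid : ∀ L : Model m →L[ℝ] Model m, L = ContinuousLinearMap.id ℝ _ →
      ∀ u, L.inverse u = u := by
    rintro _ rfl u
    rw [ContinuousLinearMap.inverse_id, ContinuousLinearMap.id_apply]
  have hr : Set.range (𝓡 (m + 2)) = Set.univ := ModelWithCorners.Boundaryless.range_eq_univ
  have hl : ∀ (A B : Model m → Model m) (x : Model m), lieBracketWithin ℝ A B
      ((extChartAt (𝓡 (m + 2)) p).symm ⁻¹' Set.univ ∩ Set.range (𝓡 (m + 2))) x =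
      fderiv ℝ B x (A x) - fderiv ℝ A x (B x) := by
    intro A B x
    rw [hr, Set.preimage_univ, Set.univ_inter, lieBracketWithin_univ, lieBracket]
  exact (hid _ mfderiv_extChartAt_self _).trans ((hl _ _ _).trans
    (fderiv_sub_fderiv_of_eventuallyEq_const hV))

end

/-! ### The flow in a chart -/

section

section FlowInChart

variable {E H M : Type*} [NormedAddCommGroup E] [NormedSpace ℝ E]
  [TopologicalSpace H] {I : ModelWithCorners ℝ E H} [TopologicalSpace M]
  [ChartedSpace H M] {φ : ℝ → M → M} {X : (x : M) → TangentSpace I x}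
  {V : Set M} {ε : ℝ} {p : M}

theorem contDiffAt_flow_in_chart [I.Boundaryless] [IsManifold I ∞ M]
    (hφ : ContMDiffAt (𝓘(ℝ, ℝ).prod I) I ∞
    (fun q : ℝ × M => φ q.1 q.2) (0, p)) (h0 : φ 0 p = p) :
    ContDiffAt ℝ ∞ (fun q : ℝ × E => extChartAt I p (φ q.1 ((extChartAt I p).symm q.2)))
      (0, extChartAt I p p) := by
  rw [← contMDiffAt_iff_contDiffAt]
  have h1 : ContMDiffAt 𝓘(ℝ, ℝ × E) (𝓘(ℝ, ℝ).prod I) ∞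
      (fun q : ℝ × E => (q.1, (extChartAt I p).symm q.2)) (0, extChartAt I p p) := by
    refine ContMDiffAt.prodMk contDiff_fst.contMDiff.contMDiffAt ?_
    have h2 : ContMDiffAt 𝓘(ℝ, E) I ∞ (extChartAt I p).symm (extChartAt I p p) :=
      (contMDiffOn_extChartAt_symm p).contMDiffAt (extChartAt_target_mem_nhds p)
    exact h2.comp (0, extChartAt I p p) contDiff_snd.contMDiff.contMDiffAt
  have h3 : ContMDiffAt 𝓘(ℝ, ℝ × E) I ∞
      (fun q : ℝ × E => φ q.1 ((extChartAt I p).symm q.2)) (0, extChartAt I p p) :=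
    ContMDiffAt.comp_of_eq hφ h1 (by simp)
  exact ContMDiffAt.comp_of_eq (contMDiffAt_extChartAt (x := p)) h3 (by simp [h0])

theorem hasMFDerivAt_flow_zero (hε : 0 < ε)
    (hi : IsMIntegralCurveOn (fun t => φ t p) X (Set.Ioo (-ε) ε)) :
    HasMFDerivAt 𝓘(ℝ, ℝ) I (fun t => φ t p) 0 ((1 : ℝ →L[ℝ] ℝ).smulRight (X (φ 0 p))) :=
  (hi 0 ⟨by linarith, hε⟩).hasMFDerivAt (Ioo_mem_nhds (by linarith) hε)

theorem hasDerivAt_comp_flow {f : M → ℝ} (hε : 0 < ε) (h0 : φ 0 p = p)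
    (hi : IsMIntegralCurveOn (fun t => φ t p) X (Set.Ioo (-ε) ε))
    (hf : MDifferentiableAt I 𝓘(ℝ, ℝ) f p) :
    HasDerivAt (fun t => f (φ t p)) (mvfderiv I f p (X p)) 0 := by
  have h1 : MDifferentiableAt I 𝓘(ℝ, ℝ) f (φ 0 p) := by rwa [h0]
  have h2 := h1.hasMFDerivAt.comp (0 : ℝ) (hasMFDerivAt_flow_zero hε hi)
  let L : E →L[ℝ] ℝ := mvfderiv I f (φ 0 p)
  let x : E := X (φ 0 p)
  have h3 : HasFDerivAt (fun t : ℝ => f (φ t p)) (L ∘L (1 : ℝ →L[ℝ] ℝ).smulRight x) 0 :=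
    hasMFDerivAt_iff_hasFDerivAt.1 h2
  have h4 : L x = mvfderiv I f p (X p) := by
    change mvfderiv I f (φ 0 p) (X (φ 0 p)) = _
    rw [h0]
  exact h3.hasDerivAt.congr_deriv ((by simp : _ = L x).trans h4)

/-- This supplies the hypothesis of `hasDerivAt_fderiv_of_partial`: it is the flow equation at time
zero, read in coordinates at every nearby point and not only at `p`. -/
theorem fderiv_flow_in_chart_time [IsManifold I ∞ M] {b : E} (hε : 0 < ε)
    (hb : b ∈ (extChartAt I p).target)
    (hF : DifferentiableAt ℝ
      (fun q : ℝ × E => extChartAt I p (φ q.1 ((extChartAt I p).symm q.2))) (0, b))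
    (h0 : φ 0 ((extChartAt I p).symm b) = (extChartAt I p).symm b)
    (hi : IsMIntegralCurveOn (fun t => φ t ((extChartAt I p).symm b)) X (Set.Ioo (-ε) ε)) :
    fderiv ℝ (fun q : ℝ × E => extChartAt I p (φ q.1 ((extChartAt I p).symm q.2))) (0, b) (1, 0) =
      mpullbackWithin 𝓘(ℝ, E) I (extChartAt I p).symm X (Set.range I) b := by
  have hz : (extChartAt I p).symm b ∈ (chartAt H p).source := by
    simpa using (extChartAt I p).map_target hb
  have h1 : HasDerivAt (fun t : ℝ => extChartAt I p (φ t ((extChartAt I p).symm b)))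
      (fderiv ℝ (fun q : ℝ × E => extChartAt I p (φ q.1 ((extChartAt I p).symm q.2)))
        (0, b) (1, 0)) 0 :=
    HasFDerivAt.comp_hasDerivAt (f := fun t : ℝ => (t, b)) (0 : ℝ) hF.hasFDerivAt
      ((hasDerivAt_id (0 : ℝ)).prodMk (hasDerivAt_const 0 b))
  have h2 := (mdifferentiableAt_extChartAt (I := I) (x := p)
    (y := φ 0 ((extChartAt I p).symm b)) (by rwa [h0])).hasMFDerivAt.comp (0 : ℝ)
    (hasMFDerivAt_flow_zero hε hi)
  let L : E →L[ℝ] E := mfderiv I 𝓘(ℝ, E) (extChartAt I p) (φ 0 ((extChartAt I p).symm b))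
  let x : E := X (φ 0 ((extChartAt I p).symm b))
  have h2' : HasFDerivAt (fun t : ℝ => extChartAt I p (φ t ((extChartAt I p).symm b)))
      (L ∘L (1 : ℝ →L[ℝ] ℝ).smulRight x) 0 := hasMFDerivAt_iff_hasFDerivAt.1 h2
  have h3 : _ = L x := (h1.unique h2'.hasDerivAt).trans (by simp)
  rw [h3]
  have h4 : mfderiv I 𝓘(ℝ, E) (extChartAt I p) (φ 0 ((extChartAt I p).symm b))
      (X (φ 0 ((extChartAt I p).symm b))) = mfderiv I 𝓘(ℝ, E) (extChartAt I p)
      ((extChartAt I p).symm b) (X ((extChartAt I p).symm b)) := by rw [h0]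
  have h5 : (mfderivWithin 𝓘(ℝ, E) I (extChartAt I p).symm (Set.range I) b).inverse
      (X ((extChartAt I p).symm b)) = mfderiv I 𝓘(ℝ, E) (extChartAt I p)
      ((extChartAt I p).symm b) (X ((extChartAt I p).symm b)) :=
    (isInvertible_mfderivWithin_extChartAt_symm hb).inverse_apply_eq.2
      (DFunLike.congr_fun (mfderivWithin_extChartAt_symm_comp_mfderiv_extChartAt hb)
        (X ((extChartAt I p).symm b))).symm
  exact h4.trans h5.symm

theorem mfderiv_flow_eq [IsManifold I ∞ M] {t : ℝ} (hφ : MDifferentiableAt I I (φ t) p)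
    (ht : φ t p ∈ (chartAt H p).source)
    (hF : DifferentiableAt ℝ
      (fun q : ℝ × E => extChartAt I p (φ q.1 ((extChartAt I p).symm q.2)))
      (t, extChartAt I p p)) (v : TangentSpace I p) :
    mfderiv I I (φ t) p v = mfderivWithin 𝓘(ℝ, E) I (extChartAt I p).symm (Set.range I)
      (extChartAt I p (φ t p)) (fderiv ℝ
        (fun q : ℝ × E => extChartAt I p (φ q.1 ((extChartAt I p).symm q.2)))
        (t, extChartAt I p p) (0, v)) := by
  have h1 : HasFDerivAt (fun b : E => extChartAt I p (φ t ((extChartAt I p).symm b)))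
      ((fderiv ℝ (fun q : ℝ × E => extChartAt I p (φ q.1 ((extChartAt I p).symm q.2)))
        (t, extChartAt I p p)).comp (ContinuousLinearMap.inr ℝ ℝ E)) (extChartAt I p p) :=
    hF.hasFDerivAt.comp _ (hasFDerivAt_prodMk_right t (extChartAt I p p))
  have h2 : HasMFDerivAt I 𝓘(ℝ, E) (fun y => extChartAt I p (φ t y)) p _ :=
    (h1.hasMFDerivAt.comp p (mdifferentiableAt_extChartAt (I := I)
      (mem_chart_source H p)).hasMFDerivAt).congr_of_eventuallyEq (by
        filter_upwards [extChartAt_source_mem_nhds (I := I) p] with y hy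
        simp only [Function.comp_apply, (extChartAt I p).left_inv hy])
  have h3 := (mdifferentiableAt_extChartAt (I := I) ht).hasMFDerivAt.comp p hφ.hasMFDerivAt
  have h4 := DFunLike.congr_fun (hasMFDerivAt_unique h2 h3) v
  have h5 : mfderiv I 𝓘(ℝ, E) (extChartAt I p) p v = v :=
    DFunLike.congr_fun (mfderiv_extChartAt_self (I := I) (x := p)) v
  have h6 : fderiv ℝ (fun q : ℝ × E => extChartAt I p (φ q.1 ((extChartAt I p).symm q.2)))
      (t, extChartAt I p p) (0, v) =
      mfderiv I 𝓘(ℝ, E) (extChartAt I p) (φ t p) (mfderiv I I (φ t) p v) := by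
    refine Eq.trans ?_ h4
    exact congrArg (fun w : E => fderiv ℝ
      (fun q : ℝ × E => extChartAt I p (φ q.1 ((extChartAt I p).symm q.2)))
      (t, extChartAt I p p) (0, w)) h5.symm
  rw [h6]
  exact (DFunLike.congr_fun (mfderivWithin_extChartAt_symm_comp_mfderiv_extChartAt' (I := I)
    (x := p) (by simpa using ht)) _).symm

/-- The components in the chart at `p` of the image of a tangent vector at `p` under the derivative
of the flow of `X`. -/
theorem exists_flow_components [I.Boundaryless] [IsManifold I ∞ M]
    (hε : 0 < ε) (hV : IsOpen V) (hp : p ∈ V)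
    (hs : ContMDiffOn (𝓘(ℝ, ℝ).prod I) I ∞ (fun q : ℝ × M => φ q.1 q.2) (Set.Ioo (-ε) ε ×ˢ V))
    (h0 : ∀ y ∈ V, φ 0 y = y)
    (hi : ∀ y ∈ V, IsMIntegralCurveOn (fun t => φ t y) X (Set.Ioo (-ε) ε))
    (v : TangentSpace I p) :
    ∃ c : ℝ → E, c 0 = v ∧
      HasDerivAt c (fderiv ℝ (mpullbackWithin 𝓘(ℝ, E) I (extChartAt I p).symm X (Set.range I))
        (extChartAt I p p) v) 0 ∧
      ∀ᶠ t in 𝓝 (0 : ℝ), mfderiv I I (φ t) p v =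
        mfderivWithin 𝓘(ℝ, E) I (extChartAt I p).symm (Set.range I) (extChartAt I p (φ t p))
          (c t) := by
  have hφ : ContMDiffAt (𝓘(ℝ, ℝ).prod I) I ∞ (fun q : ℝ × M => φ q.1 q.2) (0, p) :=
    hs.contMDiffAt ((isOpen_Ioo.prod hV).mem_nhds ⟨⟨by linarith, hε⟩, hp⟩)
  have hF := contDiffAt_flow_in_chart hφ (h0 p hp)
  have hFd : ∀ᶠ q in 𝓝 ((0 : ℝ), extChartAt I p p), DifferentiableAt ℝ
      (fun q : ℝ × E => extChartAt I p (φ q.1 ((extChartAt I p).symm q.2))) q :=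
    ((hF.of_le (m := 1) (by exact_mod_cast le_top)).eventually (by simp)).mono
      fun q hq => hq.differentiableAt (by simp)
  have hc1 : ContinuousAt (fun b : E => ((0 : ℝ), b)) (extChartAt I p p) := by fun_prop
  have hc2 : ContinuousAt (fun t : ℝ => (t, extChartAt I p p)) 0 := by fun_prop
  have hV' : ∀ᶠ b in 𝓝 (extChartAt I p p), (extChartAt I p).symm b ∈ V := by
    refine (continuousAt_extChartAt_symm p).eventually_mem (hV.mem_nhds ?_)
    rwa [extChartAt_to_inv]
  have htgt := extChartAt_target_mem_nhds (I := I) p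
  refine ⟨fun t => fderiv ℝ
    (fun q : ℝ × E => extChartAt I p (φ q.1 ((extChartAt I p).symm q.2)))
    (t, extChartAt I p p) (0, v), ?_, ?_, ?_⟩
  -- At time zero the flow is the identity near `p`, hence so is its spatial derivative in the
  -- chart.
  · have h1 : HasFDerivAt (fun b : E => extChartAt I p (φ 0 ((extChartAt I p).symm b)))
        ((fderiv ℝ (fun q : ℝ × E => extChartAt I p (φ q.1 ((extChartAt I p).symm q.2)))
          (0, extChartAt I p p)).comp (ContinuousLinearMap.inr ℝ ℝ E)) (extChartAt I p p) :=
      hFd.self_of_nhds.hasFDerivAt.comp _ (hasFDerivAt_prodMk_right (0 : ℝ) (extChartAt I p p))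
    have h2 : HasFDerivAt (fun b : E => extChartAt I p (φ 0 ((extChartAt I p).symm b)))
        (ContinuousLinearMap.id ℝ E) (extChartAt I p p) := by
      refine (hasFDerivAt_id _).congr_of_eventuallyEq ?_
      filter_upwards [hV', htgt] with b hb hb'
      rw [h0 _ hb, (extChartAt I p).right_inv hb', id]
    exact DFunLike.congr_fun (h1.unique h2) v
  · refine hasDerivAt_fderiv_of_partial (hF.of_le (ENat.LEInfty.out)) ?_ v
    filter_upwards [hc1.eventually hFd, hV', htgt] with b hb1 hb2 hb3
    exact fderiv_flow_in_chart_time hε hb3 hb1 (h0 _ hb2) (hi _ hb2)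
  · have hsrc : ∀ᶠ t in 𝓝 (0 : ℝ), φ t p ∈ (chartAt H p).source := by
      refine (hasMFDerivAt_flow_zero hε (hi p hp)).continuousAt.eventually_mem
        ((chartAt H p).open_source.mem_nhds ?_)
      rw [h0 p hp]
      exact mem_chart_source H p
    filter_upwards [hsrc, hc2.eventually hFd, Ioo_mem_nhds (neg_lt_zero.2 hε) hε] with t ht1 ht2 ht3
    refine mfderiv_flow_eq ?_ ht1 ht2 v
    have h1 : ContMDiffAt (𝓘(ℝ, ℝ).prod I) I ∞ (fun q : ℝ × M => φ q.1 q.2) (t, p) :=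
      hs.contMDiffAt ((isOpen_Ioo.prod hV).mem_nhds ⟨ht3, hp⟩)
    have h2 : ContMDiffAt I (𝓘(ℝ, ℝ).prod I) ∞ (fun y : M => (t, y)) p :=
      contMDiffAt_const.prodMk contMDiffAt_id
    exact (ContMDiffAt.comp p h1 h2).mdifferentiableAt (by simp)

end FlowInChart

/-! ### The Lie derivative of the metric -/

/-- The derivative of a family of bilinear forms along a family of vectors, where the derivative of
the forms is given by `A - L` and that of the vectors by `L`. -/
theorem hasDerivAt_bilinear_apply {n : ℕ} {β : ℝ → EuclideanSpace ℝ (Fin n) →L[ℝ]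
    EuclideanSpace ℝ (Fin n) →L[ℝ] ℝ} {A L : EuclideanSpace ℝ (Fin n) →L[ℝ]
    EuclideanSpace ℝ (Fin n)}
    (hβ : ∀ a b, HasDerivAt (fun t => β t a b) (β 0 (A a - L a) b + β 0 a (A b - L b)) 0)
    {c d : ℝ → EuclideanSpace ℝ (Fin n)} (hc : HasDerivAt c (L (c 0)) 0)
    (hd : HasDerivAt d (L (d 0)) 0) :
    HasDerivAt (fun t => β t (c t) (d t)) (β 0 (A (c 0)) (d 0) + β 0 (c 0) (A (d 0))) 0 := by
  let T : EuclideanSpace ℝ (Fin n) →L[ℝ] EuclideanSpace ℝ (Fin n) →L[ℝ] ℝ :=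
    (β 0).bilinearComp (A - L) (ContinuousLinearMap.id ℝ _) +
    (β 0).bilinearComp (ContinuousLinearMap.id ℝ _) (A - L)
  have hT : HasDerivAt β T 0 := hasDerivAt_clm fun a => hasDerivAt_clm fun b => hβ a b
  refine ((hT.clm_apply hc).clm_apply hd).congr_deriv ?_
  simp only [T, add_apply, ContinuousLinearMap.bilinearComp_apply, sub_apply, map_sub,
    ContinuousLinearMap.id_apply]
  ring

variable {m : ℕ} {M : Type*} [TopologicalSpace M] [ChartedSpace (Model m) M]
  [IsManifold (𝓡 (m + 2)) ∞ M]

/-- The derivative of `g` along the flow of `X`, i.e. the Lie derivative of `g`, in terms of the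
Levi-Civita connection. -/
theorem LorentzMetric.hasDerivAt_val_flow (g : LorentzMetric m M)
    {cov : CovariantDerivative (𝓡 (m + 2)) (Model m) (fun x : M => TangentSpace (𝓡 (m + 2)) x)}
    (hcov : g.IsLeviCivita cov) {X : (x : M) → TangentSpace (𝓡 (m + 2)) x} {U V : Set M} {ε : ℝ}
    {φ : ℝ → M → M} {p : M} (hX : DiffVectorFieldAt X p) (hε : 0 < ε) (hV : IsOpen V)
    (hp : p ∈ V) (hφ : IsLocalFlow X U ε V φ) (v w : TangentSpace (𝓡 (m + 2)) p) :
    HasDerivAt (fun t => g.val (φ t p) (mfderiv (𝓡 (m + 2)) (𝓡 (m + 2)) (φ t) p v)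
        (mfderiv (𝓡 (m + 2)) (𝓡 (m + 2)) (φ t) p w))
      (g.val p (cov X p v) w + g.val p v (cov X p w)) 0 := by
  obtain ⟨c, hc0, hc, hct⟩ := exists_flow_components hε hV hp hφ.smooth hφ.zero hφ.integral v
  obtain ⟨d, hd0, hd, hdt⟩ := exists_flow_components hε hV hp hφ.smooth hφ.zero hφ.integral w
  let B : M → Model m →L[ℝ] Model m →L[ℝ] ℝ := fun z => g.val z
  let D : M → Model m →L[ℝ] Model m := fun z => mfderivWithin 𝓘(ℝ, Model m) (𝓡 (m + 2))
    (extChartAt (𝓡 (m + 2)) p).symm (Set.range (𝓡 (m + 2))) (extChartAt (𝓡 (m + 2)) p z)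
  let A : Model m →L[ℝ] Model m := cov X p
  let L : Model m →L[ℝ] Model m := fderiv ℝ (mpullbackWithin 𝓘(ℝ, Model m) (𝓡 (m + 2))
    (extChartAt (𝓡 (m + 2)) p).symm X (Set.range (𝓡 (m + 2)))) (extChartAt (𝓡 (m + 2)) p p)
  have hBD : ∀ z ∈ (chartAt (Model m) p).source, ∀ a b : TangentSpace (𝓡 (m + 2)) p,
      (B z).bilinearComp (D z) (D z) a b =
        g.val z (extend (Model m) a z) (extend (Model m) b z) := by
    intro z hz a b
    rw [extend_eq_mfderivWithin hz, extend_eq_mfderivWithin hz]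
    rfl
  have hB0 : ∀ a b : TangentSpace (𝓡 (m + 2)) p,
      (B (φ 0 p)).bilinearComp (D (φ 0 p)) (D (φ 0 p)) a b = g.val p a b := by
    intro a b
    rw [hφ.zero p hp, hBD p (mem_chart_source _ p), extend_apply_self, extend_apply_self]
  have hsub : ∀ x y z : Model m, x - y = -z → x = y - z := fun x y z h => by
    rw [sub_eq_iff_eq_add.1 h]
    abel
  -- Zero torsion: differentiating a chart-constant field along `X` equals `∇X` plus the bracket,
  -- and the bracket contributes `-L`.
  have hh : ∀ a : TangentSpace (𝓡 (m + 2)) p, cov (extend (Model m) a) p (X p) = A a - L a := by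
    intro a
    have h1 := (CovariantDerivative.torsion_eq_zero_iff cov).1 hcov.1 hX
      (LorentzMetric.diffVectorFieldAt_extend a)
    rw [extend_apply_self] at h1
    exact hsub _ _ _ (h1.trans (mlieBracket_extend a))
  have hsrc : ∀ᶠ t in 𝓝 (0 : ℝ), φ t p ∈ (chartAt (Model m) p).source := by
    refine (hasMFDerivAt_flow_zero hε (hφ.integral p hp)).continuousAt.eventually_mem
      ((chartAt (Model m) p).open_source.mem_nhds ?_)
    rw [hφ.zero p hp]
    exact mem_chart_source _ p
  have hβ : ∀ a b : TangentSpace (𝓡 (m + 2)) p, HasDerivAt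
      (fun t => (B (φ t p)).bilinearComp (D (φ t p)) (D (φ t p)) a b)
      ((B (φ 0 p)).bilinearComp (D (φ 0 p)) (D (φ 0 p)) (A a - L a) b +
        (B (φ 0 p)).bilinearComp (D (φ 0 p)) (D (φ 0 p)) a (A b - L b)) 0 := by
    intro a b
    have ha := LorentzMetric.diffVectorFieldAt_extend a
    have hb := LorentzMetric.diffVectorFieldAt_extend b
    have h1 := hasDerivAt_comp_flow hε (hφ.zero p hp) (hφ.integral p hp)
      (g.mdifferentiableAt_val ha hb)
    rw [hcov.2 p _ _ ha hb, extend_apply_self, extend_apply_self] at h1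
    refine (h1.congr_of_eventuallyEq (hsrc.mono fun t ht => hBD _ ht a b)).congr_deriv ?_
    exact congrArg₂ (· + ·) ((congrArg (fun x => g.val p x b) (hh a)).trans (hB0 _ _).symm)
      ((congrArg (fun x => g.val p a x) (hh b)).trans (hB0 _ _).symm)
  have hc' : HasDerivAt c (L (c 0)) 0 := by rwa [hc0]
  have hd' : HasDerivAt d (L (d 0)) 0 := by rwa [hd0]
  -- The chart-dependent `L` from the moving components `c`, `d` cancels the `-L` from the
  -- coefficients of `g`, leaving the covariant expression.
  have hmain := hasDerivAt_bilinear_apply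
    (β := fun t => (B (φ t p)).bilinearComp (D (φ t p)) (D (φ t p))) hβ hc' hd'
  rw [hc0, hd0] at hmain
  refine (hmain.congr_of_eventuallyEq ?_).congr_deriv
    (congrArg₂ (· + ·) (hB0 (cov X p v) w) (hB0 v (cov X p w)))
  filter_upwards [hct, hdt] with t h1 h2
  rw [h1, h2]
  rfl

end

section

/-! ### Linear algebra of null frames -/

theorem eta_comm {m : ℕ} (v w : Model m) : eta v w = eta w v := by
  simp only [eta, mul_comm, add_comm]

theorem eta_vecK {m : ℕ} (w : Model m) : eta (vecK m) w = w 1 := by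
  simp [eta, vecK]

theorem eta_vecK_self (m : ℕ) : eta (vecK m) (vecK m) = 0 := by
  rw [eta_vecK]
  simp [vecK]

/-- An endomorphism which is infinitesimally isometric on `{k}^⊥ × {k}^⊥` and on `ℝk × ℝⁿ` is
trace-free. -/
theorem trace_eq_zero_of_eta {m : ℕ} {a : Model m →ₗ[ℝ] Model m}
    (h1 : ∀ v w, eta (vecK m) v = 0 → eta (vecK m) w = 0 → eta (a v) w + eta v (a w) = 0)
    (h2 : ∀ w, eta (a (vecK m)) w + eta (vecK m) (a w) = 0) :
    LinearMap.trace ℝ (Model m) a = 0 := by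
  have hne : ∀ i : Fin m, (1 : Fin (m + 2)) ≠ i.succ.succ := fun i => by simp [Fin.ext_iff]
  -- The diagonal entries at the mᵢ vanish individually; those at k and l only cancel each other, by
  -- the second hypothesis evaluated at l.
  have h3 : ∀ i : Fin m, a (EuclideanSpace.single i.succ.succ 1) i.succ.succ = 0 := fun i => by
    have hk : eta (vecK m) (EuclideanSpace.single i.succ.succ 1) = 0 := by
      rw [eta_vecK]
      simp [hne]
    have h := h1 _ _ hk hk
    rw [eta_comm _ (a _)] at h
    simp [eta, Fin.succ_inj, hne] at h
    linarith
  have h4 := h2 (EuclideanSpace.single 1 1)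
  rw [eta_vecK] at h4
  rw [LinearMap.trace_eq_sum_inner a (EuclideanSpace.basisFun (Fin (m + 2)) ℝ), Fin.sum_univ_succ,
    Fin.sum_univ_succ]
  simp [eta, vecK, Fin.ext_iff] at h4
  simp [EuclideanSpace.inner_single_left, h3]
  linarith

variable {m : ℕ} {M : Type*} [TopologicalSpace M] [ChartedSpace (Model m) M]
  [IsManifold (𝓡 (m + 2)) ∞ M]

namespace LorentzMetric

variable (g : LorentzMetric m M)

theorem exists_val_eq {x : M} (ρ : TangentSpace (𝓡 (m + 2)) x →ₗ[ℝ] ℝ) :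
    ∃ r, ∀ w, g.val x r w = ρ w := by
  have : FiniteDimensional ℝ (TangentSpace (𝓡 (m + 2)) x) :=
    inferInstanceAs (FiniteDimensional ℝ (Model m))
  refine ⟨((g.form x).toDual (g.form_nondegenerate x)).symm ρ, fun w => ?_⟩
  change g.form x _ w = _
  rw [← LinearMap.BilinForm.toDual_def (B := g.form x) (b := g.form_nondegenerate x),
    LinearEquiv.apply_symm_apply]

/-- The numbers g(v₀, bᵢ) are the coordinates of `v₀` in the `g`-dual basis, so contracting with a
product of covectors g(v₀, ·) and g(w₀, ·) is evaluation at the vectors. -/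
theorem contract_val_mul_val {x : M} (v₀ w₀ : TangentSpace (𝓡 (m + 2)) x)
    (F : TangentSpace (𝓡 (m + 2)) x →ₗ[ℝ] TangentSpace (𝓡 (m + 2)) x →ₗ[ℝ] ℝ) :
    g.contract x (fun v w => g.val x v₀ v * g.val x w₀ w) (fun v w => F v w) = F v₀ w₀ := by
  have : FiniteDimensional ℝ (TangentSpace (𝓡 (m + 2)) x) :=
    inferInstanceAs (FiniteDimensional ℝ (Model m))
  have hrep : ∀ v, v = ∑ i, g.val x v (Module.finBasis ℝ (TangentSpace (𝓡 (m + 2)) x) i) •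
      LinearMap.BilinForm.dualBasis (g.form x) (g.form_nondegenerate x)
        (Module.finBasis ℝ (TangentSpace (𝓡 (m + 2)) x)) i := fun v => by
    conv_lhs => rw [← (LinearMap.BilinForm.dualBasis (g.form x) (g.form_nondegenerate x)
        (Module.finBasis ℝ (TangentSpace (𝓡 (m + 2)) x))).sum_repr v]
    refine Finset.sum_congr rfl fun i _ => ?_
    rw [LinearMap.BilinForm.dualBasis_repr_apply]
    rfl
  conv_rhs => rw [hrep v₀, hrep w₀, LinearMap.map_sum₂]
  simp only [contract, map_sum, map_smul, LinearMap.smul_apply, smul_eq_mul]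
  exact Finset.sum_congr rfl fun i _ => Finset.sum_congr rfl fun j _ => by ring

theorem contract_add_left {x : M}
    (S S' T : TangentSpace (𝓡 (m + 2)) x → TangentSpace (𝓡 (m + 2)) x → ℝ) :
    g.contract x (fun v w => S v w + S' v w) T = g.contract x S T + g.contract x S' T := by
  simp only [contract, add_mul, Finset.sum_add_distrib]

/-- If the symmetric part of `g(A ·, ·)` vanishes on `{K}^⊥ × {K}^⊥` and on `ℝK × T_x M`, the
contraction of the symmetric part with `g(A ·, ·)` vanishes. -/
theorem contract_eq_zero {x : M} {A : TangentSpace (𝓡 (m + 2)) x →ₗ[ℝ] TangentSpace (𝓡 (m + 2)) x}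
    {K L : TangentSpace (𝓡 (m + 2)) x} (hL : g.val x K L = 1)
    (h1 : ∀ v w, g.val x K v = 0 → g.val x K w = 0 → g.val x (A v) w + g.val x (A w) v = 0)
    (h2 : ∀ w, g.val x (A K) w + g.val x (A w) K = 0) :
    g.contract x (fun v w => (g.val x (A v) w + g.val x (A w) v) / 2)
      (fun v w => g.val x (A v) w) = 0 := by
  let F : TangentSpace (𝓡 (m + 2)) x →ₗ[ℝ] TangentSpace (𝓡 (m + 2)) x →ₗ[ℝ] ℝ := g.form x ∘ₗ A
  have hF : ∀ v w, g.val x (A v) w = F v w := fun v w => rfl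
  -- With S the symmetric part of `F`, the choice g(r, w) = S(L, w) - ½ S(L, L) g(K, w) is the one
  -- forced by S = K ⊗ r + r ⊗ K (indices lowered) and g(K, L) = 1.
  obtain ⟨r, hr⟩ := g.exists_val_eq
    ((2⁻¹ : ℝ) • (F L + F.flip L) - (2⁻¹ * F L L) • g.form x K)
  have hr' : ∀ w, g.val x r w = (F L w + F w L) / 2 - F L L / 2 * g.val x K w := fun w => by
    rw [hr]
    simp only [LinearMap.sub_apply, LinearMap.smul_apply, LinearMap.add_apply, LinearMap.flip_apply,
      smul_eq_mul]
    change _ - _ * g.val x K w = _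
    ring
  simp only [hF] at h1 h2 ⊢
  have hperp : ∀ v, g.val x K (v - g.val x K v • L) = 0 := fun v => by
    rw [map_sub, map_smul, hL, smul_eq_mul, mul_one, sub_self]
  have hS : (fun v w => (F v w + F w v) / 2) =
      fun v w => g.val x K v * g.val x r w + g.val x r v * g.val x K w := by
    funext v w
    -- Project `v` and `w` to {K}^⊥ along `L` and expand the vanishing of S on the projections.
    have h := h1 _ _ (hperp v) (hperp w)
    simp only [map_sub, map_smul, LinearMap.sub_apply, LinearMap.smul_apply, smul_eq_mul] at h
    rw [hr', hr']
    linear_combination h / 2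
  rw [hS, contract_add_left, contract_val_mul_val, contract_val_mul_val]
  -- The contraction has become F(K, r) + F(r, K).
  exact h2 r

end LorentzMetric

end

section

variable {m : ℕ} {M : Type*} [TopologicalSpace M] [ChartedSpace (Model m) M]
  [IsManifold (𝓡 (m + 2)) ∞ M]

/-! ### Metrics belonging to a Kundt structure -/

theorem GStructure.fibre_nonempty {G : Subgroup (Model m ≃L[ℝ] Model m)} (P : GStructure G M)
    (x : M) : ∃ u, u ∈ P.fibre x := by
  obtain ⟨U, -, hx, s, hs, -⟩ := P.exists_section x
  exact ⟨s x, hs x hx⟩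

namespace LorentzMetric

variable {g : LorentzMetric m M} {P : GStructure (GN m) M}

/-- A frame of `P` is a `GN`-translate of a frame in the `Sim`-reduction, where `g` is η, and `GN`
preserves η on {k}^⊥. -/
theorem BelongsTo.val_perp (hg : g.BelongsTo P) {x : M}
    {u : Model m ≃L[ℝ] TangentSpace (𝓡 (m + 2)) x} (hu : u ∈ P.fibre x) {w w' : Model m}
    (hw : eta (vecK m) w = 0) (hw' : eta (vecK m) w' = 0) :
    g.val x (u w) (u w') = eta w w' := by
  obtain ⟨Q, hQ⟩ := hg
  obtain ⟨q, hq⟩ := Q.fibre_nonempty x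
  obtain ⟨a, ⟨-, h2, -⟩, rfl⟩ := P.transitive x q ((hQ x).1 hq) u hu
  rw [← h2 w w' hw hw', ← (hQ x).2 q hq]
  rfl

theorem BelongsTo.val_vecK (hg : g.BelongsTo P) {x : M}
    {u : Model m ≃L[ℝ] TangentSpace (𝓡 (m + 2)) x} (hu : u ∈ P.fibre x) (w : Model m) :
    g.val x (u (vecK m)) (u w) = eta (vecK m) w := by
  obtain ⟨Q, hQ⟩ := hg
  obtain ⟨q, hq⟩ := Q.fibre_nonempty x
  obtain ⟨a, ⟨-, -, h3⟩, rfl⟩ := P.transitive x q ((hQ x).1 hq) u hu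
  rw [← h3 w, ← (hQ x).2 q hq]
  rfl

theorem BelongsTo.val_lam (hg : g.BelongsTo P) {x : M} {v : TangentSpace (𝓡 (m + 2)) x}
    (hv : v ∈ P.lam x) : g.val x v v = 0 := by
  obtain ⟨u, hu⟩ := P.fibre_nonempty x
  have hv' : v ∈ (P.lam x : Set (TangentSpace (𝓡 (m + 2)) x)) := hv
  rw [P.lam_eq x u hu] at hv'
  obtain ⟨c, rfl⟩ := hv'
  rw [map_smul u, map_smul (g.val x), smul_apply, map_smul, hg.val_vecK hu, eta_vecK_self,
    smul_zero, smul_zero]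

theorem BelongsTo.perp_lam (hg : g.BelongsTo P) : g.perp P.lam = P.Lam := by
  funext x
  obtain ⟨u, hu⟩ := P.fibre_nonempty x
  apply SetLike.coe_injective
  rw [P.Lam_eq x u hu]
  ext v
  have hmem : v ∈ g.perp P.lam x ↔ ∀ n ∈ P.lam x, g.val x n v = 0 := Iff.rfl
  rw [SetLike.mem_coe, hmem]
  constructor
  · intro h
    refine ⟨u.symm v, ?_, (u.apply_symm_apply v).symm⟩
    rw [← hg.val_vecK hu, u.apply_symm_apply]
    exact h _ (Submodule.subset_span ⟨u, hu, 1, by rw [one_smul]⟩)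
  · rintro ⟨w, hw, rfl⟩ n hn
    have hn' : n ∈ (P.lam x : Set (TangentSpace (𝓡 (m + 2)) x)) := hn
    rw [P.lam_eq x u hu] at hn'
    obtain ⟨c, rfl⟩ := hn'
    rw [map_smul, map_smul, smul_apply, hg.val_vecK hu, hw, smul_zero]

/-- The flow of an infinitesimal automorphism of `P` preserves the components of `g` which are
determined by `P`. -/
theorem val_cov_add_val_cov_eq_zero
    {cov : CovariantDerivative (𝓡 (m + 2)) (Model m) (fun x : M => TangentSpace (𝓡 (m + 2)) x)}
    (hcov : g.IsLeviCivita cov) {X : (x : M) → TangentSpace (𝓡 (m + 2)) x} {U : Set M}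
    (hX : IsInfinitesimalAutomorphismOn P X U) {x : M} (hx : x ∈ U) (hXx : DiffVectorFieldAt X x)
    {u : Model m ≃L[ℝ] TangentSpace (𝓡 (m + 2)) x} (hu : u ∈ P.fibre x) {w w' : Model m} {r : ℝ}
    (hr : ∀ y, ∀ u' ∈ P.fibre y, g.val y (u' w) (u' w') = r) :
    g.val x (cov X x (u w)) (u w') + g.val x (u w) (cov X x (u w')) = 0 := by
  obtain ⟨ε, V, φ, hε, hV, hxV, -, hφ, hfr⟩ := hX x hx
  -- The component stays equal to `r` along the flow, so the Lie derivative computed from `∇X` is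
  -- the derivative of a constant.
  refine (g.hasDerivAt_val_flow hcov hXx hε hV hxV hφ (u w) (u w')).unique ?_
  refine (hasDerivAt_const (0 : ℝ) r).congr_of_eventuallyEq ?_
  filter_upwards [Ioo_mem_nhds (neg_lt_zero.2 hε) hε] with t ht
  obtain ⟨u', hu', h⟩ := hfr t ht x hxV u hu
  rw [h, h, hr _ _ hu']

theorem BelongsTo.isGeodesicShearDivFreeOn (hg : g.BelongsTo P)
    {cov : CovariantDerivative (𝓡 (m + 2)) (Model m) (fun x : M => TangentSpace (𝓡 (m + 2)) x)}
    (hcov : g.IsLeviCivita cov) {X : (x : M) → TangentSpace (𝓡 (m + 2)) x} {U : Set M}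
    (hU : IsOpen U) (hX : SmoothVectorFieldOn X U) (hXl : ∀ x ∈ U, X x ∈ P.lam x)
    (hXa : IsInfinitesimalAutomorphismOn P X U) : g.IsGeodesicShearDivFreeOn cov X U := by
  intro x hx
  obtain ⟨u, hu⟩ := P.fibre_nonempty x
  have hXx : DiffVectorFieldAt X x :=
    ((hX x hx).contMDiffAt (hU.mem_nhds hx)).mdifferentiableAt (by simp)
  have h1 : ∀ w w', eta (vecK m) w = 0 → eta (vecK m) w' = 0 →
      g.val x (cov X x (u w)) (u w') + g.val x (u w) (cov X x (u w')) = 0 := fun w w' hw hw' =>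
    val_cov_add_val_cov_eq_zero hcov hXa hx hXx hu fun _ _ hu' => hg.val_perp hu' hw hw'
  have h2 : ∀ w, g.val x (cov X x (u (vecK m))) (u w) + g.val x (u (vecK m)) (cov X x (u w)) = 0 :=
    fun w => val_cov_add_val_cov_eq_zero hcov hXa hx hXx hu fun _ _ hu' => hg.val_vecK hu' w
  refine ⟨?_, ?_, ?_⟩
  · have hXx' : X x ∈ (P.lam x : Set (TangentSpace (𝓡 (m + 2)) x)) := hXl x hx
    rw [P.lam_eq x u hu] at hXx'
    obtain ⟨c, hc⟩ := hXx'
    refine g.ext_of_val fun z => ?_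
    have h3 : g.val x (cov X x (X x)) z + g.val x (X x) (cov X x z) = 0 := by
      have := h2 (u.symm z)
      rw [u.apply_symm_apply] at this
      rw [hc, map_smul, map_smul, map_smul, map_smul, smul_apply, smul_apply, ← smul_add, this,
        smul_zero]
    -- Metric compatibility turns g(X, ∇_z X) into half the derivative of g(X, X), which vanishes
    -- near `x` because λ is null.
    have h4 := hcov.2 x X X hXx hXx z
    have h5 : (fun y => g.val y (X y) (X y)) =ᶠ[𝓝 x] (fun _ => 0 : M → ℝ) := by
      filter_upwards [hU.mem_nhds hx] with y hy using hg.val_lam (hXl y hy)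
    have h6 : mvfderiv (𝓡 (m + 2)) (fun y => g.val y (X y) (X y)) x z = 0 :=
      DFunLike.congr_fun (h5.mfderiv_eq.trans mfderiv_const) z
    rw [h6, g.symm x _ (X x)] at h4
    rw [map_zero, zero_apply]
    linarith
  · have h7 : ∀ v w : TangentSpace (𝓡 (m + 2)) x, g.val x (u (vecK m)) v = 0 →
        g.val x (u (vecK m)) w = 0 → g.val x (cov X x v) w + g.val x (cov X x w) v = 0 := by
      intro v w hv hw
      rw [← u.apply_symm_apply v, hg.val_vecK hu] at hv
      rw [← u.apply_symm_apply w, hg.val_vecK hu] at hw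
      have := h1 _ _ hv hw
      rwa [u.apply_symm_apply, u.apply_symm_apply, g.symm x v] at this
    have h8 : ∀ w : TangentSpace (𝓡 (m + 2)) x, g.val x (cov X x (u (vecK m))) w +
        g.val x (cov X x w) (u (vecK m)) = 0 := by
      intro w
      have := h2 (u.symm w)
      rwa [u.apply_symm_apply, g.symm x (u (vecK m))] at this
    refine g.contract_eq_zero (A := (cov X x).toLinearMap) (K := u (vecK m))
      (L := u (EuclideanSpace.single 1 1)) ?_ h7 h8
    rw [hg.val_vecK hu, eta_vecK]
    simp
  -- A frame of the reduction is needed here: it carries all of `g` to η, so `∇X` becomes an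
  -- endomorphism of Minkowski space with the same trace.
  · obtain ⟨Q, hQ⟩ := id hg
    obtain ⟨q, hq⟩ := Q.fibre_nonempty x
    obtain ⟨hqP, hqη⟩ := hQ x
    have hqP := hqP hq
    have hqη := hqη q hq
    have h7 : ∀ v w, g.val x (cov X x (q v)) (q w) = eta (q.symm (cov X x (q v))) w := fun v w => by
      rw [← hqη, q.apply_symm_apply]
    have h8 : ∀ v w, g.val x (q v) (cov X x (q w)) = eta v (q.symm (cov X x (q w))) := fun v w => by
      rw [← hqη, q.apply_symm_apply]
    let a : Model m →ₗ[ℝ] Model m := q.symm.toLinearEquiv.conj (cov X x).toLinearMap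
    have ha : LinearMap.trace ℝ (Model m) a = 0 := trace_eq_zero_of_eta
      (fun v w hv hw => by
        have := val_cov_add_val_cov_eq_zero hcov hXa hx hXx hqP fun _ _ hu' => hg.val_perp hu' hv hw
        rwa [h7, h8] at this)
      (fun w => by
        have := val_cov_add_val_cov_eq_zero hcov hXa hx hXx hqP fun _ _ hu' => hg.val_vecK hu' w
        rwa [h7, h8] at this)
    rwa [LinearMap.trace_conj'] at ha

end LorentzMetric

end

end Kundt

end

theorem mainTheorem3 (m : ℕ) (M : Type*) [TopologicalSpace M] [T2Space M]
    [ChartedSpace (Kundt.Model m) M] [IsManifold (𝓡 (m + 2)) ∞ M]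
    (P : Kundt.GStructure (Kundt.GN m) M) (hP : Kundt.IsKundtStructure P)
    (g : Kundt.LorentzMetric m M) (hg : g.BelongsTo P) :
    g.IsKundtSpacetime P.lam := by
  refine ⟨⟨fun p => ?_, fun x v hv => hg.val_lam hv⟩, ?_, g.leviCivita, g.isLeviCivita_leviCivita,
    fun p => ?_⟩
  -- The local automorphism field itself serves as the smooth section spanning λ.
  · obtain ⟨U, X, hU, hp, hX, hXl, -⟩ := hP.2 p
    refine ⟨U, X, hU, hp, hX, fun x hx => ⟨(hXl x hx).2, ?_⟩⟩
    obtain ⟨u, hu⟩ := P.fibre_nonempty x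
    have hXx : X x ∈ (P.lam x : Set (TangentSpace (𝓡 (m + 2)) x)) := (hXl x hx).1
    rw [P.lam_eq x u hu] at hXx
    obtain ⟨c, hc⟩ := hXx
    have hc0 : c ≠ 0 := by
      rintro rfl
      exact (hXl x hx).2 (by rw [hc, zero_smul, map_zero])
    refine le_antisymm (fun v hv => ?_)
      ((Submodule.span_singleton_le_iff_mem _ _).2 (hXl x hx).1)
    have hv' : v ∈ (P.lam x : Set (TangentSpace (𝓡 (m + 2)) x)) := hv
    rw [P.lam_eq x u hu] at hv'
    obtain ⟨d, rfl⟩ := hv'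
    refine Submodule.mem_span_singleton.2 ⟨d / c, ?_⟩
    rw [hc, ← map_smul, smul_smul, div_mul_cancel₀ _ hc0]
  · rw [hg.perp_lam]
    exact hP.1
  · obtain ⟨U, X, hU, hp, hX, hXl, hXa⟩ := hP.2 p
    exact ⟨U, X, hU, hp, hX, hXl, hg.isGeodesicShearDivFreeOn g.isLeviCivita_leviCivita hU hX
      (fun x hx => (hXl x hx).1) hXa⟩
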